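/- **Setting.** Let $\sigma\in\mathbb R$, $\mathbf q_0\in\mathbb C^2\setminus\{0\}$, $q_0=\|\mathbf q_0\|$, $\delta_\pm\in\mathbb R$ and $\mathbf q_\pm=\mathbf q_0e^{i\delta_\pm}$. Let $\mathbf q(x,t)\in\mathbb C^2$ be a classical solution (for $x,t\in\mathbb R$) of the defocusing-defocusing coupled Hirota equations $$i\mathbf q_t+\mathbf q_{xx}-2(\|\mathbf q\|^2-q_0^2)\mathbf q+i\sigma\big[\mathbf q_{xxx}-3\|\mathbf q\|^2\mathbf q_x-3(\mathbf q^\dagger\mathbf q_x)\mathbf q\big]=\mathbf 0,\qquad \lim_{x\to\pm\infty}\mathbf q(x,t)=\mathbf q_\pm ,$$ such that, for every $t$ and every $a\in\mathbb R$, $\mathbf q(\cdot,t)-\mathbf q_-\in L^1(-\infty,a)$ and $\mathbf q(\cdot,t)-\mathbf q_+\in L^1(a,\infty)$. For $z\in\mathbb C\setminus\{0\}$ put $k=\tfrac12(z+q_0^2/z)$, $\lambda=\tfrac12(z-q_0^2/z)$, and let $$\mathbf J=\operatorname{diag}(1,-1,-1),\quad \mathbf Q=\begin{pmatrix}0&-\mathbf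 q^\dagger\\ \mathbf q&\mathbf 0\end{pmatrix},\quad \mathbf X=ik\mathbf J+i\mathbf Q,\quad \mathbf Y_\pm=\begin{pmatrix} i&0&q_0/z\\ i\mathbf q_\pm/z&\mathbf q_\pm^\perp/q_0&\mathbf q_\pm/q_0\end{pmatrix},$$ $$\begin{aligned}\mathbf T={}&4i\sigma k^3\mathbf J-iq_0^2\mathbf J+k^2(4i\sigma\mathbf Q+2i\mathbf J)+k(2i\mathbf Q-2\sigma\mathbf Q_x\mathbf J-2i\sigma\mathbf J\mathbf Q^2)-2i\sigma\mathbf Q^3-i\mathbf J\mathbf Q^2\\&-i\sigma\mathbf Q_{xx}-\mathbf Q_x\mathbf J+\sigma[\mathbf Q,\mathbf Q_x],\end{aligned}$$ where $(v_1,v_2)^{T\perp}=(v_2,-v_1)^\dagger$, and $\mathbf\Delta=\operatorname{diag}(\delta_1,\delta_2,-\delta_1)$ with $\delta_1=\lambda x+2\lambda[k+\sigma(3k^2-\lambda^2)]t$ and $\delta_2=-kx-(\lambda^2+k^2+4\sigma k^3)t$. For $z\in E:=\mathbb R\setminus\{0,\pm q_0\}$ the Jost solutions $\psi_\pm(z;\cdot,t)$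 at time $t$ are the solutions of $\psi_x=\mathbf X\psi$ with $\psi_\pm=\mathbf Y_\pm e^{i\mathbf\Delta}+o(1)$ as $x\to\pm\infty$, and the scattering matrix $\mathbf H(z)=(h_{ij}(z))$ at time $t$ is defined by $\psi_+=\psi_-\mathbf H$. **Theorem.** For every $t$ and every $z\in E$ the Jost solutions exist and are unique, and $\mathbf H(z)$ is well defined and invertible; put $\mathbf S=\mathbf H^{-1}=(s_{ij})$. If $\psi_\pm$ satisfy also $\psi_t=\mathbf T\psi$ (so that they are simultaneous solutions of the Lax pair), then $\mathbf H(z)$ does not depend on $t$, and $\psi_+=\psi_-\mathbf H(z)$ for all $x,t$. Moreover, the scattering coefficients extend analytically off the real axis as follows: $$s_{33}\text{ and }h_{11}\text{ to } \mathbb D^+=\{\operatorname{Im}z>0\},\qquad s_{11}\text{ and }h_{33}\text{ to }\mathbb D^-=\{\operatorname{Im}z<0\};$$ that is, for each of these coefficients $f$, with $D$ the corresponding half plane, there is a function that is analytic in $D$, continuous on $D\cup E$, and equal to $f$ on $E$. -/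

import Mathlib

open Filter Topology MeasureTheory

noncomputable section

namespace CoupledHirota

/-- Two-component complex vectors, with the Hermitian norm. -/
abbrev Vec : Type := EuclideanSpace ℂ (Fin 2)

/-- Complex `3 × 3` matrices. -/
abbrev Mat : Type := Matrix (Fin 3) (Fin 3) ℂ

/-- `q x t` is a classical solution of the defocusing-defocusing coupled Hirota equations
`i q_t + q_xx - 2 (‖q‖² - q₀²) q + i σ [q_xxx - 3 ‖q‖² q_x - 3 (q† q_x) q] = 0`. -/
structure IsHirotaSolution (σ q₀ : ℝ) (q : ℝ → ℝ → Vec) : Prop where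
  contDiff_x : ∀ t, ContDiff ℝ 3 (fun x => q x t)
  differentiable_t : ∀ x, Differentiable ℝ (fun t => q x t)
  equation : ∀ x t : ℝ,
    Complex.I • deriv (fun s => q x s) t
      + iteratedDeriv 2 (fun y => q y t) x
      - (2 * (‖q x t‖ ^ 2 - q₀ ^ 2)) • q x t
      + (Complex.I * (σ : ℂ)) •
          (iteratedDeriv 3 (fun y => q y t) x
            - (3 * ‖q x t‖ ^ 2) • deriv (fun y => q y t) x
            - (3 * inner ℂ (q x t) (deriv (fun y => q y t) x)) • q x t) = 0

/-- The matrix `J = diag(1, -1, -1)`. -/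
def J : Mat := Matrix.diagonal ![1, -1, -1]

/-- The matrix `Q` with blocks `0`, `-v†`, `v`, `0` built from a vector `v`. -/
def Q (v : Vec) : Mat :=
  !![0, -star (v 0), -star (v 1);
     v 0, 0, 0;
     v 1, 0, 0]

/-- `k(z) = (z + q₀² / z) / 2`. -/
def kk (q₀ : ℝ) (z : ℂ) : ℂ := (z + (q₀ : ℂ) ^ 2 / z) / 2

/-- `λ(z) = (z - q₀² / z) / 2`. -/
def lam (q₀ : ℝ) (z : ℂ) : ℂ := (z - (q₀ : ℂ) ^ 2 / z) / 2

/-- The matrix `X = i k J + i Q` of the spatial part of the Lax pair, where `v` is the value of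
the potential. -/
def X (q₀ : ℝ) (z : ℂ) (v : Vec) : Mat :=
  (Complex.I * kk q₀ z) • J + Complex.I • Q v

/-- The matrix `T` of the temporal part of the Lax pair, where `v`, `v₁`, `v₂` are the values
of the potential and of its first two `x`-derivatives. -/
def T (σ q₀ : ℝ) (z : ℂ) (v v₁ v₂ : Vec) : Mat :=
  (4 * Complex.I * σ * kk q₀ z ^ 3) • J
    - (Complex.I * (q₀ : ℂ) ^ 2) • J
    + (kk q₀ z ^ 2) • ((4 * Complex.I * σ) • Q v + (2 * Complex.I) • J)
    + (kk q₀ z) • ((2 * Complex.I) • Q v - (2 * (σ : ℂ)) • (Q v₁ * J)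
        - (2 * Complex.I * σ) • (J * Q v ^ 2))
    - (2 * Complex.I * σ) • Q v ^ 3
    - Complex.I • (J * Q v ^ 2)
    - (Complex.I * σ) • Q v₂
    - Q v₁ * J
    + (σ : ℂ) • (Q v * Q v₁ - Q v₁ * Q v)

/-- The eigenvector matrix `Y` of the asymptotic Lax pair with boundary value `w`; its columns are
`(i, i w / z)`, `(0, w⊥ / q₀)` and `(q₀ / z, w / q₀)`, where `w⊥ = (w₂, -w₁)†`. -/
def Y (q₀ : ℝ) (w : Vec) (z : ℂ) : Mat :=
  !![Complex.I, 0, (q₀ : ℂ) / z;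
     Complex.I * w 0 / z, star (w 1) / (q₀ : ℂ), w 0 / (q₀ : ℂ);
     Complex.I * w 1 / z, -star (w 0) / (q₀ : ℂ), w 1 / (q₀ : ℂ)]

/-- The phase `δ₁ = λ x + 2 λ [k + σ (3 k² - λ²)] t`. -/
def phase₁ (σ q₀ : ℝ) (z : ℂ) (x t : ℝ) : ℂ :=
  lam q₀ z * x + 2 * lam q₀ z * (kk q₀ z + σ * (3 * kk q₀ z ^ 2 - lam q₀ z ^ 2)) * t

/-- The phase `δ₂ = -k x - (λ² + k² + 4 σ k³) t`. -/
def phase₂ (σ q₀ : ℝ) (z : ℂ) (x t : ℝ) : ℂ :=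
  -kk q₀ z * x - (lam q₀ z ^ 2 + kk q₀ z ^ 2 + 4 * σ * kk q₀ z ^ 3) * t

/-- The matrix `exp (i Δ)`, where `Δ = diag(δ₁, δ₂, -δ₁)`. -/
def expPhase (σ q₀ : ℝ) (z : ℂ) (x t : ℝ) : Mat :=
  Matrix.diagonal ![Complex.exp (Complex.I * phase₁ σ q₀ z x t),
    Complex.exp (Complex.I * phase₂ σ q₀ z x t),
    Complex.exp (-(Complex.I * phase₁ σ q₀ z x t))]

/-- The punctured continuous spectrum `ℝ \ {0, q₀, -q₀}` in the variable `z`. -/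
def spectrumSet (q₀ : ℝ) : Set ℝ := {z | z ≠ 0 ∧ z ≠ q₀ ∧ z ≠ -q₀}

/-- `Ψ` is the Jost solution at time `t` and spectral parameter `z`: it solves `Ψ_x = X Ψ` on the
whole line and `Ψ = Y exp (i Δ) + o(1)` along `l`. Here `l` is `atTop` (for `ψ₊`) or `atBot`
(for `ψ₋`), and `w` is the corresponding boundary value of the potential. -/
def IsJost (σ q₀ : ℝ) (q : ℝ → ℝ → Vec) (l : Filter ℝ) (w : Vec) (t z : ℝ)
    (Ψ : ℝ → Mat) : Prop :=
  (∀ x i j, HasDerivAt (fun y => Ψ y i j) ((X q₀ z (q x t) * Ψ x) i j) x) ∧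
    Tendsto (fun x => Ψ x - Y q₀ w z * expPhase σ q₀ z x t) l (𝓝 0)

/-- `Ψ x t` is a simultaneous Jost solution of the Lax pair `Ψ_x = X Ψ`, `Ψ_t = T Ψ`. -/
def IsLaxJost (σ q₀ : ℝ) (q : ℝ → ℝ → Vec) (l : Filter ℝ) (w : Vec) (z : ℝ)
    (Ψ : ℝ → ℝ → Mat) : Prop :=
  (∀ t, IsJost σ q₀ q l w t z (fun x => Ψ x t)) ∧
    ∀ x t i j, HasDerivAt (fun s => Ψ x s i j)
      ((T σ q₀ z (q x t) (deriv (fun y => q y t) x) (iteratedDeriv 2 (fun y => q y t) x)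
        * Ψ x t) i j) t

/-- `H` is the scattering matrix at time `t` and spectral parameter `z`: `ψ₊ = ψ₋ H`, where
`wm`, `wp` are the boundary values of the potential at `-∞` and `+∞`. -/
def IsScatteringMatrix (σ q₀ : ℝ) (q : ℝ → ℝ → Vec) (wm wp : Vec) (t z : ℝ) (H : Mat) : Prop :=
  ∃ Ψm Ψp : ℝ → Mat, IsJost σ q₀ q atBot wm t z Ψm ∧ IsJost σ q₀ q atTop wp t z Ψp ∧
    ∀ x, Ψp x = Ψm x * H

/-- The upper half plane. -/
def Dplus : Set ℂ := {z | 0 < z.im}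

/-- The lower half plane. -/
def Dminus : Set ℂ := {z | z.im < 0}

/-- The function `f`, given on the set `E` of real numbers, extends analytically off the real axis
to the open set `D`: some function is analytic in `D`, continuous on `D ∪ E`, and equal to `f`
on `E`. -/
def ExtendsAnalytically (f : ℝ → ℂ) (E : Set ℝ) (D : Set ℂ) : Prop :=
  ∃ F : ℂ → ℂ, AnalyticOnNhd ℂ F D ∧ ContinuousOn F (D ∪ Complex.ofReal '' E) ∧
    ∀ z ∈ E, F (z : ℂ) = f z

end CoupledHirota

end

open CoupledHirota

/-! ### Integrals over half lines and parametric integrals -/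

/-! At each end of the line the matrix `X` differs from its limit `Y diag(μ) Y⁻¹`, where `μ = (iλ,
-ik, -iλ)`, by an integrable matrix `B`. At `+∞`, writing the `j`-th Jost column (up to its time
factor) as `exp (μ_j x) Y w` leads to the Volterra equation `w(x) = e_j - ∫_{s > x} exp ((x -
s)(diag μ - μ_j)) Y⁻¹ B(s) Y w(s) ds`. If `Re μ_j ≤ Re μ_i` for all `i`, the exponentials are
bounded by 1, and in the weight `exp (2 ∫_{r > x} m)` the operator has norm at most 1/2. The Neumann
series therefore converges without any smallness, locally uniformly in `z`. Its sum is holomorphic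
on open sets where `Re μ_j` is minimal and continuous up to their regular boundary points
(`volterraSol_eq`, `differentiableOn_jost`, `continuousOn_jost`). The end `-∞` is reached by the
reflection `x ↦ -x`.

For `z ∈ E` all `μ_i` are imaginary, so every column exists. The inverse `R` of the fundamental
matrix `Ψ` is built in the same way from the adjoint system: `R Ψ` is constant and its asymptotics
force it to be 1 (`jostPair_atTop`). Boundedness of `R` yields uniqueness
(`JostPair.eq_of_tendsto`), and `H = R₋ Ψ₊`, `S = R₊ Ψ₋`.

A diagonal entry of `H` pairs a row of `R₋` with the column of `Ψ₊` of the same index, and the time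
factors cancel. Reflection and passage to the adjoint each reverse the sign of `μ`, so both factors
of `h_jj` extend where `Re μ_j` is smallest, and both factors of `s_jj` where it is largest. As `|Im
k| ≤ |Im λ|` and `Im λ` has the sign of `Im z`, the first and third eigenvalues are the extremal
ones and exchange roles between the half planes.

Simultaneous Jost solutions satisfy, at fixed `x`, one and the same linear equation in `t`, so `ψ₋⁻¹
ψ₊` is constant in `t`; this ratio is `H`. -/

theorem hasDerivAt_integral_Ioi_left {E : Type*} [NormedAddCommGroup E] [NormedSpace ℝ E]
    [CompleteSpace E] {f : ℝ → E}
    (hf : Continuous f) (hi : ∀ a, IntegrableOn f (Set.Ioi a)) (x : ℝ) :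
    HasDerivAt (fun x => ∫ s in Set.Ioi x, f s) (-f x) x := by
  have h : (fun x => ∫ s in Set.Ioi x, f s)
      = fun x => (∫ s in Set.Ioi (0 : ℝ), f s) - ∫ s in (0 : ℝ)..x, f s := by
    funext y
    rw [← intervalIntegral.integral_Ioi_sub_Ioi' (hi 0) (hi y), sub_sub_cancel]
  rw [h]
  exact (intervalIntegral.integral_hasDerivAt_right (hf.intervalIntegrable _ _)
    (hf.stronglyMeasurableAtFilter _ _) hf.continuousAt).const_sub _

theorem tendsto_integral_Ioi_atTop_zero {E : Type*} [NormedAddCommGroup E] [NormedSpace ℝ E]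
    [CompleteSpace E] {f : ℝ → E} (hi : ∀ a, IntegrableOn f (Set.Ioi a)) :
    Tendsto (fun x => ∫ s in Set.Ioi x, f s) atTop (𝓝 0) := by
  have h : (fun x => ∫ s in Set.Ioi x, f s)
      = fun x => (∫ s in Set.Ioi (0 : ℝ), f s) - ∫ s in (0 : ℝ)..x, f s := by
    funext y
    rw [← intervalIntegral.integral_Ioi_sub_Ioi' (hi 0) (hi y), sub_sub_cancel]
  rw [h]
  simpa using (intervalIntegral_tendsto_integral_Ioi 0 (hi 0) tendsto_id).const_sub
    (∫ s in Set.Ioi (0 : ℝ), f s)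

/-- The integrand is the derivative of `-exp (2 ∫_{r > s} m) / 2`. The factor 2 in the exponent
becomes the contraction constant 1/2 of the Volterra operator. -/
theorem integral_mul_exp_tail {m : ℝ → ℝ} (hm : Continuous m) (hm0 : ∀ s, 0 ≤ m s)
    (hmi : ∀ a, IntegrableOn m (Set.Ioi a)) (x : ℝ) :
    IntegrableOn (fun s => m s * Real.exp (2 * ∫ r in Set.Ioi s, m r)) (Set.Ioi x) ∧
      ∫ s in Set.Ioi x, m s * Real.exp (2 * ∫ r in Set.Ioi s, m r)
        = (Real.exp (2 * ∫ r in Set.Ioi x, m r) - 1) / 2 := by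
  have hd : ∀ y ∈ Set.Ici x, HasDerivAt
      (fun s => -(Real.exp (2 * ∫ r in Set.Ioi s, m r)) / 2)
      (m y * Real.exp (2 * ∫ r in Set.Ioi y, m r)) y := by
    intro y _
    have := (((hasDerivAt_integral_Ioi_left hm hmi y).const_mul 2).exp.neg).div_const 2
    refine this.congr_deriv ?_
    ring
  have hl : Tendsto (fun s => -(Real.exp (2 * ∫ r in Set.Ioi s, m r)) / 2) atTop
      (𝓝 (-(Real.exp (2 * 0)) / 2)) :=
    ((Real.continuous_exp.tendsto _).comp
      ((tendsto_integral_Ioi_atTop_zero hmi).const_mul 2)).neg.div_const 2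
  have hp : ∀ y ∈ Set.Ioi x, 0 ≤ m y * Real.exp (2 * ∫ r in Set.Ioi y, m r) :=
    fun y _ => mul_nonneg (hm0 y) (Real.exp_pos _).le
  refine ⟨integrableOn_Ioi_deriv_of_nonneg' hd hp hl, ?_⟩
  rw [integral_Ioi_of_hasDerivAt_of_nonneg' hd hp hl]
  simp
  ring

/-- Cauchy's estimate turns the bound on `F` into a bound on its `z`-derivative, so no separate
majorant of the derivative is needed. -/
theorem differentiableOn_integral_of_dominated {α E : Type*} [MeasurableSpace α]
    {μ : Measure α} [NormedAddCommGroup E] [NormedSpace ℂ E] [CompleteSpace E]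
    {F : ℂ → α → E} {g : α → ℝ} {U : Set ℂ} (hU : IsOpen U)
    (hmeas : ∀ z ∈ U, AEStronglyMeasurable (F z) μ)
    (hd : ∀ a, DifferentiableOn ℂ (fun z => F z a) U) (hg : Integrable g μ)
    (hb : ∀ᵐ a ∂μ, ∀ z ∈ U, ‖F z a‖ ≤ g a) :
    DifferentiableOn ℂ (fun z => ∫ a, F z a ∂μ) U := by
  intro z₀ hz₀
  obtain ⟨r, hr, hrU⟩ := Metric.isOpen_iff.1 hU z₀ hz₀
  have hmem : ∀ z ∈ Metric.ball z₀ (r / 2), Metric.closedBall z (r / 3) ⊆ U := by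
    intro z hz w hw
    apply hrU
    rw [Metric.mem_ball] at hz ⊢
    rw [Metric.mem_closedBall] at hw
    linarith [dist_triangle w z z₀]
  have hball : ∀ z ∈ Metric.ball z₀ (r / 2), z ∈ U := fun z hz =>
    hmem z hz (Metric.mem_closedBall_self (by positivity))
  have hz₀' : z₀ ∈ Metric.ball z₀ (r / 2) := Metric.mem_ball_self (by positivity)
  have hder : ∀ a, ∀ z ∈ Metric.ball z₀ (r / 2),
      HasDerivAt (F · a) (deriv (F · a) z) z := fun a z hz =>
    ((hd a).differentiableAt (hU.mem_nhds (hball z hz))).hasDerivAt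
  refine (hasDerivAt_integral_of_dominated_loc_of_deriv_le (F := F)
    (F' := fun z a => deriv (F · a) z) (bound := fun a => g a / (r / 3))
    (Metric.ball_mem_nhds z₀ (half_pos hr)) ?_ ?_ ?_ ?_ (hg.div_const _)
    (ae_of_all _ hder)).2.differentiableAt.differentiableWithinAt
  · filter_upwards [hU.mem_nhds hz₀] with z hz using hmeas z hz
  · exact hg.mono' (hmeas _ hz₀) (hb.mono fun a ha => ha _ hz₀)
  -- The derivative is measurable as a pointwise limit of difference quotients; the steps are at
  -- most `r / 3`, so the shifted points stay in `U`.
  · have hε : Tendsto (fun n : ℕ => ((r / 3 / (n + 1) : ℝ) : ℂ)) atTop (𝓝[≠] 0) := by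
      refine tendsto_nhdsWithin_iff.2 ⟨?_, Eventually.of_forall fun n => ?_⟩
      · have := (tendsto_const_div_atTop_nhds_zero_nat (r / 3)).comp (tendsto_add_atTop_nat 1)
        have h2 := (Complex.continuous_ofReal.tendsto 0).comp this
        simpa [Function.comp_def] using h2
      · have : (0 : ℝ) < r / 3 / (n + 1) := by positivity
        simp only [Set.mem_compl_iff, Set.mem_singleton_iff, Complex.ofReal_eq_zero]
        exact this.ne'
    refine aestronglyMeasurable_of_tendsto_ae atTop
      (f := fun (n : ℕ) a => ((r / 3 / (n + 1) : ℝ) : ℂ)⁻¹ •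
        (F (z₀ + ((r / 3 / (n + 1) : ℝ) : ℂ)) a - F z₀ a)) (fun n => ?_) (ae_of_all _ fun a => ?_)
    · refine (AEStronglyMeasurable.sub (hmeas _ ?_) (hmeas _ hz₀)).const_smul _
      apply hmem z₀ hz₀'
      have h1 : (0 : ℝ) ≤ r / 3 / (n + 1) := by positivity
      rw [Metric.mem_closedBall, dist_eq_norm, add_sub_cancel_left, Complex.norm_real,
        Real.norm_of_nonneg h1]
      exact div_le_self (by positivity) (by linarith [n.cast_nonneg (α := ℝ)])
    · exact (hasDerivAt_iff_tendsto_slope_zero.1 (hder a z₀ hz₀')).comp hε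
  · filter_upwards [hb] with a ha z hz
    refine Complex.norm_deriv_le_of_forall_mem_sphere_norm_le (by positivity) ?_ ?_
    · refine DifferentiableOn.diffContOnCl ?_
      rw [closure_ball _ (by positivity)]
      exact (hd a).mono (hmem z hz)
    · intro w hw
      exact ha w (hmem z hz (Metric.sphere_subset_closedBall hw))

noncomputable section

/-! ### Linear Volterra equations on half lines -/

variable {ι : Type*} [Fintype ι]

/-- The Volterra operator
`u ↦ (x ↦ ∫_{s > x} exp ((x - s) diag ν) (C s) (u s) ds)`. -/
def volterraOp (ν : ι → ℂ) (C : ℝ → Matrix ι ι ℂ) (u : ℝ → ι → ℂ) (x : ℝ) (i : ι) : ℂ :=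
  ∫ s in Set.Ioi x, Complex.exp (ν i * (x - s)) * (C s).mulVec (u s) i

/-- The terms of the Neumann series of `u = b - volterraOp ν C u`. -/
def volterraTerm (ν : ι → ℂ) (C : ℝ → Matrix ι ι ℂ) (b : ι → ℂ) : ℕ → ℝ → ι → ℂ
  | 0 => fun _ => b
  | n + 1 => fun x i => -volterraOp ν C (volterraTerm ν C b n) x i

/-- The solution of `u = b - volterraOp ν C u`. -/
def volterraSol (ν : ι → ℂ) (C : ℝ → Matrix ι ι ℂ) (b : ι → ℂ) (x : ℝ) (i : ι) : ℂ :=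
  ∑' n, volterraTerm ν C b n x i

/-- The kernel given by `ν` and `C` is dissipative and dominated by the integrable function `m`. -/
structure VolterraBound (ν : ι → ℂ) (C : ℝ → Matrix ι ι ℂ) (m : ℝ → ℝ) : Prop where
  re_nonneg : ∀ i, 0 ≤ (ν i).re
  continuous_kernel : ∀ i l, Continuous fun s => C s i l
  continuous_bound : Continuous m
  nonneg : ∀ s, 0 ≤ m s
  integrableOn : ∀ a, IntegrableOn m (Set.Ioi a)
  le : ∀ s i, ∑ l, ‖C s i l‖ ≤ m s

/-- The weight `exp (2 ∫_{r > x} m r dr)`. -/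
def tailWeight (m : ℝ → ℝ) (x : ℝ) : ℝ := Real.exp (2 * ∫ r in Set.Ioi x, m r)

namespace VolterraBound

variable {ν : ι → ℂ} {C : ℝ → Matrix ι ι ℂ} {m : ℝ → ℝ} {u : ℝ → ι → ℂ} {c : ℝ} {b : ι → ℂ}

theorem integrableOn_mul_tailWeight (h : VolterraBound ν C m) (x : ℝ) :
    IntegrableOn (fun s => m s * tailWeight m s) (Set.Ioi x) :=
  (integral_mul_exp_tail h.continuous_bound h.nonneg h.integrableOn x).1

theorem integral_mul_tailWeight (h : VolterraBound ν C m) (x : ℝ) :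
    ∫ s in Set.Ioi x, m s * tailWeight m s = (tailWeight m x - 1) / 2 :=
  (integral_mul_exp_tail h.continuous_bound h.nonneg h.integrableOn x).2

theorem tendsto_tailWeight (h : VolterraBound ν C m) : Tendsto (tailWeight m) atTop (𝓝 1) := by
  have := (Real.continuous_exp.tendsto _).comp
    ((tendsto_integral_Ioi_atTop_zero h.integrableOn).const_mul 2)
  simp only [mul_zero, Real.exp_zero] at this
  exact this

theorem tailWeight_anti (h : VolterraBound ν C m) {x y : ℝ} (hxy : x ≤ y) :
    tailWeight m y ≤ tailWeight m x := by
  refine Real.exp_le_exp.2 (mul_le_mul_of_nonneg_left ?_ zero_le_two)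
  exact setIntegral_mono_set (h.integrableOn x) (ae_of_all _ h.nonneg)
    (Set.Ioi_subset_Ioi hxy).eventuallyLE

theorem norm_exp_le (h : VolterraBound ν C m) {x s : ℝ} (hxs : x ≤ s) (i : ι) :
    ‖Complex.exp (ν i * (x - s))‖ ≤ 1 := by
  rw [Complex.norm_exp, Real.exp_le_one_iff]
  have : (ν i * (x - s)).re = (ν i).re * (x - s) := by
    rw [← Complex.ofReal_sub, Complex.re_mul_ofReal]
  rw [this]
  exact mul_nonpos_of_nonneg_of_nonpos (h.re_nonneg i) (by linarith)

theorem norm_mulVec_le (h : VolterraBound ν C m) {s d : ℝ} {v : ι → ℂ} (hv : ∀ l, ‖v l‖ ≤ d)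
    (i : ι) : ‖(C s).mulVec v i‖ ≤ m s * d := by
  have hd : 0 ≤ d := (norm_nonneg _).trans (hv i)
  calc ‖(C s).mulVec v i‖ ≤ ∑ l, ‖C s i l * v l‖ := norm_sum_le _ _
    _ ≤ ∑ l, ‖C s i l‖ * d := Finset.sum_le_sum fun l _ => by
        rw [norm_mul]; exact mul_le_mul_of_nonneg_left (hv l) (norm_nonneg _)
    _ ≤ m s * d := by
        rw [← Finset.sum_mul]; exact mul_le_mul_of_nonneg_right (h.le s i) hd

theorem norm_integrand_le (h : VolterraBound ν C m) {x s d : ℝ} (hxs : x ≤ s) {v : ι → ℂ}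
    (hv : ∀ l, ‖v l‖ ≤ d) (i : ι) :
    ‖Complex.exp (ν i * (x - s)) * (C s).mulVec v i‖ ≤ m s * d := by
  rw [norm_mul]
  exact (mul_le_of_le_one_left (norm_nonneg _) (h.norm_exp_le hxs i)).trans
    (h.norm_mulVec_le hv i)

theorem continuous_mulVec (h : VolterraBound ν C m) (hu : ∀ i, Continuous fun s => u s i) (i : ι) :
    Continuous fun s => (C s).mulVec (u s) i := by
  simp only [Matrix.mulVec, dotProduct]
  exact continuous_finsetSum _ fun l _ => (h.continuous_kernel i l).mul (hu l)

theorem continuous_integrand (h : VolterraBound ν C m) (hu : ∀ i, Continuous fun s => u s i)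
    (x : ℝ) (i : ι) :
    Continuous fun s : ℝ => Complex.exp (ν i * (x - s)) * (C s).mulVec (u s) i :=
  (by fun_prop : Continuous fun s : ℝ => Complex.exp (ν i * (x - s))).mul
    (h.continuous_mulVec hu i)

theorem integrableOn_integrand (h : VolterraBound ν C m) (hu : ∀ i, Continuous fun s => u s i)
    (hc : ∀ s i, ‖u s i‖ ≤ c * tailWeight m s) (x : ℝ) (i : ι) :
    IntegrableOn (fun s : ℝ => Complex.exp (ν i * (x - s)) * (C s).mulVec (u s) i)
      (Set.Ioi x) := by
  refine ((h.integrableOn_mul_tailWeight x).const_mul c).mono'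
    (h.continuous_integrand hu x i).aestronglyMeasurable ?_
  filter_upwards [ae_restrict_mem measurableSet_Ioi] with s hs
  exact (h.norm_integrand_le (le_of_lt hs) (hc s) i).trans_eq (by ring)

/-- Dropping the `-1` on the right shows the norm in the weight `tailWeight m` to be at most 1/2,
however large `m` is. -/
theorem norm_volterraOp_le (h : VolterraBound ν C m)
    (hc : ∀ s i, ‖u s i‖ ≤ c * tailWeight m s) (x : ℝ) (i : ι) :
    ‖volterraOp ν C u x i‖ ≤ c * ((tailWeight m x - 1) / 2) := by
  rw [← h.integral_mul_tailWeight, ← integral_const_mul]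
  refine norm_integral_le_of_norm_le ((h.integrableOn_mul_tailWeight x).const_mul c) ?_
  filter_upwards [ae_restrict_mem measurableSet_Ioi] with s hs
  exact (h.norm_integrand_le (le_of_lt hs) (hc s) i).trans_eq (by ring)

/-- Splitting `exp (ν (x - s))` moves the dependence on `x` into a prefactor and the lower limit of
integration, so the product rule applies. -/
theorem hasDerivAt_volterraOp (h : VolterraBound ν C m) (hu : ∀ i, Continuous fun s => u s i)
    (hc : ∀ s i, ‖u s i‖ ≤ c * tailWeight m s) (x : ℝ) (i : ι) :
    HasDerivAt (fun y => volterraOp ν C u y i)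
      (ν i * volterraOp ν C u x i - (C x).mulVec (u x) i) x := by
  set f : ℝ → ℂ := fun s => Complex.exp (ν i * (0 - s)) * (C s).mulVec (u s) i
  have hf : Continuous f :=
    (by fun_prop : Continuous fun s : ℝ => Complex.exp (ν i * (0 - s))).mul
      (h.continuous_mulVec hu i)
  have hsplit : ∀ y s : ℝ, Complex.exp (ν i * (y - s)) * (C s).mulVec (u s) i
      = Complex.exp (ν i * y) * f s := by
    intro y s
    simp only [f]
    rw [← mul_assoc, ← Complex.exp_add]
    ring_nf
  have hfi : ∀ a, IntegrableOn f (Set.Ioi a) := by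
    intro a
    have h1 := (h.integrableOn_integrand hu hc a i).const_mul (Complex.exp (ν i * a))⁻¹
    refine h1.congr (ae_of_all _ fun s => ?_)
    simp only [hsplit]
    rw [inv_mul_cancel_left₀ (Complex.exp_ne_zero _)]
  have hop : (fun y => volterraOp ν C u y i)
      = fun y : ℝ => Complex.exp (ν i * y) * ∫ s in Set.Ioi y, f s := by
    funext y
    simp only [volterraOp, hsplit, integral_const_mul]
  have hopx := congrFun hop x
  rw [hop, hopx]
  have he : HasDerivAt (fun y : ℝ => Complex.exp (ν i * y)) (Complex.exp (ν i * x) * ν i) x := by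
    simpa using ((hasDerivAt_id x).ofReal_comp.const_mul (ν i)).cexp
  refine (he.mul (hasDerivAt_integral_Ioi_left hf hfi x)).congr_deriv ?_
  have hx := hsplit x x
  simp only [sub_self, mul_zero, Complex.exp_zero, one_mul] at hx
  rw [hx]
  ring

theorem continuous_volterraOp (h : VolterraBound ν C m) (hu : ∀ i, Continuous fun s => u s i)
    (hc : ∀ s i, ‖u s i‖ ≤ c * tailWeight m s) (i : ι) :
    Continuous fun y => volterraOp ν C u y i :=
  continuous_iff_continuousAt.2 fun x => (h.hasDerivAt_volterraOp hu hc x i).continuousAt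

theorem volterraTerm_spec (h : VolterraBound ν C m) (hb : ∀ i, ‖b i‖ ≤ 1) (n : ℕ) :
    (∀ i, Continuous fun x => volterraTerm ν C b n x i) ∧
      ∀ x i, ‖volterraTerm ν C b n x i‖ ≤ (1 / 2) ^ n * tailWeight m x := by
  induction n with
  | zero =>
    refine ⟨fun i => continuous_const, fun x i => ?_⟩
    have : 1 ≤ tailWeight m x := Real.one_le_exp
      (mul_nonneg zero_le_two (integral_nonneg h.nonneg))
    simpa [volterraTerm] using (hb i).trans this
  | succ n ih =>
    refine ⟨fun i => (h.continuous_volterraOp ih.1 ih.2 i).neg, fun x i => ?_⟩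
    simp only [volterraTerm, norm_neg]
    refine (h.norm_volterraOp_le ih.2 x i).trans ?_
    have : (0 : ℝ) < (1 / 2) ^ n := by positivity
    rw [pow_succ, mul_assoc]
    exact mul_le_mul_of_nonneg_left (by linarith) this.le

theorem summable_volterraTerm (h : VolterraBound ν C m) (hb : ∀ i, ‖b i‖ ≤ 1) (x : ℝ) (i : ι) :
    Summable fun n => volterraTerm ν C b n x i :=
  Summable.of_norm_bounded (summable_geometric_two.mul_right (tailWeight m x))
    fun n => (h.volterraTerm_spec hb n).2 x i

theorem norm_volterraSol_le (h : VolterraBound ν C m) (hb : ∀ i, ‖b i‖ ≤ 1) (x : ℝ) (i : ι) :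
    ‖volterraSol ν C b x i‖ ≤ 2 * tailWeight m x :=
  tsum_of_norm_bounded (hasSum_geometric_two.mul_right (tailWeight m x))
    fun n => (h.volterraTerm_spec hb n).2 x i

theorem continuous_volterraSol (h : VolterraBound ν C m) (hb : ∀ i, ‖b i‖ ≤ 1) (i : ι) :
    Continuous fun x => volterraSol ν C b x i := by
  refine continuous_iff_continuousAt.2 fun x => ?_
  -- The weight decreases, so its value at `x - 1` bounds the series uniformly on a neighbourhood of
  -- `x`.
  have : ContinuousOn (fun y => volterraSol ν C b y i) (Set.Ici (x - 1)) := by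
    refine continuousOn_tsum (fun n => ((h.volterraTerm_spec hb n).1 i).continuousOn)
      (summable_geometric_two.mul_right (tailWeight m (x - 1))) fun n y hy => ?_
    exact ((h.volterraTerm_spec hb n).2 y i).trans
      (mul_le_mul_of_nonneg_left (h.tailWeight_anti hy) (by positivity))
  exact this.continuousAt (Ici_mem_nhds (by linarith))

theorem volterraSol_eq (h : VolterraBound ν C m) (hb : ∀ i, ‖b i‖ ≤ 1) (x : ℝ) (i : ι) :
    volterraSol ν C b x i = b i - volterraOp ν C (volterraSol ν C b) x i := by
  have hs : HasSum (fun n => volterraOp ν C (volterraTerm ν C b n) x i)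
      (volterraOp ν C (volterraSol ν C b) x i) := by
    refine hasSum_integral_of_dominated_convergence
      (fun n s => (1 / 2) ^ n * (m s * tailWeight m s))
      (fun n => (h.continuous_integrand (h.volterraTerm_spec hb n).1 x i).aestronglyMeasurable)
      (fun n => ?_) (ae_of_all _ fun s => summable_geometric_two.mul_right _) ?_
      (ae_of_all _ fun s => ?_)
    · filter_upwards [ae_restrict_mem measurableSet_Ioi] with s hs
      exact (h.norm_integrand_le (le_of_lt hs) ((h.volterraTerm_spec hb n).2 s) i).trans_eq
        (by ring)
    · simp_rw [tsum_mul_right]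
      exact (h.integrableOn_mul_tailWeight x).const_mul _
    · refine HasSum.mul_left _ ?_
      simp only [Matrix.mulVec, dotProduct]
      exact hasSum_sum fun l _ => (h.summable_volterraTerm hb s l).hasSum.mul_left _
  have h0 := (h.summable_volterraTerm hb x i).tsum_eq_zero_add
  rw [volterraSol, h0, ← hs.tsum_eq, sub_eq_add_neg, ← tsum_neg]
  rfl

/-- The condition `ν i * b i = 0` says that the constant `b` solves the unperturbed system. -/
theorem hasDerivAt_volterraSol (h : VolterraBound ν C m) (hb : ∀ i, ‖b i‖ ≤ 1)
    (hνb : ∀ i, ν i * b i = 0) (x : ℝ) (i : ι) :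
    HasDerivAt (fun y => volterraSol ν C b y i)
      (ν i * volterraSol ν C b x i + (C x).mulVec (volterraSol ν C b x) i) x := by
  have hd := (h.hasDerivAt_volterraOp (h.continuous_volterraSol hb) (h.norm_volterraSol_le hb)
    x i).const_sub (b i)
  have he : (fun y => volterraSol ν C b y i)
      = fun y => b i - volterraOp ν C (volterraSol ν C b) y i :=
    funext fun y => h.volterraSol_eq hb y i
  rw [he]
  refine hd.congr_deriv ?_
  have hx := congrArg (ν i * ·) (h.volterraSol_eq hb x i)
  simp only [mul_sub, hνb i] at hx
  rw [hx]
  ring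

theorem tendsto_volterraSol (h : VolterraBound ν C m) (hb : ∀ i, ‖b i‖ ≤ 1) (i : ι) :
    Tendsto (fun x => volterraSol ν C b x i) atTop (𝓝 (b i)) := by
  refine tendsto_iff_norm_sub_tendsto_zero.2 (squeeze_zero (fun _ => norm_nonneg _)
    (g := fun x => 2 * ((tailWeight m x - 1) / 2)) (fun x => ?_) ?_)
  · rw [h.volterraSol_eq hb, sub_sub_cancel_left, norm_neg]
    exact h.norm_volterraOp_le (h.norm_volterraSol_le hb) x i
  · simpa using ((h.tendsto_tailWeight.sub_const 1).div_const 2).const_mul 2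

end VolterraBound

/-! ### Dependence on a parameter -/

theorem continuousOn_volterraTerm {ν : ℂ → ι → ℂ} {C : ℂ → ℝ → Matrix ι ι ℂ} {m : ℝ → ℝ}
    {b : ι → ℂ} {S : Set ℂ} (h : ∀ z ∈ S, VolterraBound (ν z) (C z) m) (hb : ∀ i, ‖b i‖ ≤ 1)
    (hν : ∀ i, ContinuousOn (fun z => ν z i) S)
    (hC : ∀ s i l, ContinuousOn (fun z => C z s i l) S) (n : ℕ) (x : ℝ) (i : ι) :
    ContinuousOn (fun z => volterraTerm (ν z) (C z) b n x i) S := by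
  induction n generalizing x i with
  | zero => exact continuousOn_const
  | succ n ih =>
    -- A point of `S` is needed only to obtain integrability of the majorant, which does not depend
    -- on `z`.
    rcases S.eq_empty_or_nonempty with rfl | ⟨z₀, hz₀⟩
    · exact continuousOn_empty _
    refine ContinuousOn.neg (continuousOn_of_dominated
      (bound := fun s => (1 / 2) ^ n * (m s * tailWeight m s)) (fun z hz => ?_) (fun z hz => ?_)
      (((h z₀ hz₀).integrableOn_mul_tailWeight x).const_mul _) (ae_of_all _ fun s => ?_))
    · exact ((h z hz).continuous_integrand
        ((h z hz).volterraTerm_spec hb n).1 x i).aestronglyMeasurable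
    · filter_upwards [ae_restrict_mem measurableSet_Ioi] with s hs
      exact ((h z hz).norm_integrand_le (le_of_lt hs)
        (((h z hz).volterraTerm_spec hb n).2 s) i).trans_eq (by ring)
    · refine ContinuousOn.mul (((hν i).mul continuousOn_const).cexp) ?_
      simp only [Matrix.mulVec, dotProduct]
      exact continuousOn_finsetSum _ fun l _ => (hC s i l).mul (ih s l)

theorem differentiableOn_volterraTerm {ν : ℂ → ι → ℂ} {C : ℂ → ℝ → Matrix ι ι ℂ} {m : ℝ → ℝ}
    {b : ι → ℂ} {U : Set ℂ} (hU : IsOpen U) (h : ∀ z ∈ U, VolterraBound (ν z) (C z) m)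
    (hb : ∀ i, ‖b i‖ ≤ 1) (hν : ∀ i, DifferentiableOn ℂ (fun z => ν z i) U)
    (hC : ∀ s i l, DifferentiableOn ℂ (fun z => C z s i l) U) (n : ℕ) (x : ℝ) (i : ι) :
    DifferentiableOn ℂ (fun z => volterraTerm (ν z) (C z) b n x i) U := by
  induction n generalizing x i with
  | zero => exact differentiableOn_const _
  | succ n ih =>
    rcases U.eq_empty_or_nonempty with rfl | ⟨z₀, hz₀⟩
    · exact differentiableOn_empty
    refine DifferentiableOn.neg (differentiableOn_integral_of_dominated
      (g := fun s => (1 / 2) ^ n * (m s * tailWeight m s)) hU (fun z hz => ?_) (fun s => ?_)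
      (((h z₀ hz₀).integrableOn_mul_tailWeight x).const_mul _) ?_)
    · exact ((h z hz).continuous_integrand
        ((h z hz).volterraTerm_spec hb n).1 x i).aestronglyMeasurable
    · refine DifferentiableOn.mul (((hν i).mul (differentiableOn_const _)).cexp) ?_
      simp only [Matrix.mulVec, dotProduct]
      exact DifferentiableOn.fun_sum fun l _ => (hC s i l).mul (ih s l)
    · filter_upwards [ae_restrict_mem measurableSet_Ioi] with s hs z hz
      exact ((h z hz).norm_integrand_le (le_of_lt hs)
        (((h z hz).volterraTerm_spec hb n).2 s) i).trans_eq (by ring)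

theorem continuousOn_volterraSol {ν : ℂ → ι → ℂ} {C : ℂ → ℝ → Matrix ι ι ℂ} {m : ℝ → ℝ}
    {b : ι → ℂ} {S : Set ℂ} (h : ∀ z ∈ S, VolterraBound (ν z) (C z) m) (hb : ∀ i, ‖b i‖ ≤ 1)
    (hν : ∀ i, ContinuousOn (fun z => ν z i) S)
    (hC : ∀ s i l, ContinuousOn (fun z => C z s i l) S) (x : ℝ) (i : ι) :
    ContinuousOn (fun z => volterraSol (ν z) (C z) b x i) S :=
  continuousOn_tsum (fun n => continuousOn_volterraTerm h hb hν hC n x i)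
    (summable_geometric_two.mul_right (tailWeight m x))
    fun n z hz => ((h z hz).volterraTerm_spec hb n).2 x i

theorem differentiableOn_volterraSol {ν : ℂ → ι → ℂ} {C : ℂ → ℝ → Matrix ι ι ℂ} {m : ℝ → ℝ}
    {b : ι → ℂ} {U : Set ℂ} (hU : IsOpen U) (h : ∀ z ∈ U, VolterraBound (ν z) (C z) m)
    (hb : ∀ i, ‖b i‖ ≤ 1) (hν : ∀ i, DifferentiableOn ℂ (fun z => ν z i) U)
    (hC : ∀ s i l, DifferentiableOn ℂ (fun z => C z s i l) U) (x : ℝ) (i : ι) :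
    DifferentiableOn ℂ (fun z => volterraSol (ν z) (C z) b x i) U :=
  Complex.differentiableOn_tsum_of_summable_norm
    (summable_geometric_two.mul_right (tailWeight m x))
    (fun n => differentiableOn_volterraTerm hU h hb hν hC n x i) hU
    fun n z hz => ((h z hz).volterraTerm_spec hb n).2 x i

end

noncomputable section

/-! ### Jost solutions of a linear system with asymptotically constant coefficients -/

variable {ι : Type*} [Fintype ι]

/-- The sum of the absolute values of the entries of a matrix. -/
def entrySum (A : Matrix ι ι ℂ) : ℝ := ∑ a, ∑ b, ‖A a b‖

theorem entrySum_nonneg (A : Matrix ι ι ℂ) : 0 ≤ entrySum A :=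
  Finset.sum_nonneg fun _ _ => Finset.sum_nonneg fun _ _ => norm_nonneg _

theorem row_le_entrySum (A : Matrix ι ι ℂ) (i : ι) : ∑ l, ‖A i l‖ ≤ entrySum A :=
  Finset.single_le_sum (f := fun a => ∑ b, ‖A a b‖)
    (fun _ _ => Finset.sum_nonneg fun _ _ => norm_nonneg _) (Finset.mem_univ i)

theorem entrySum_mul_le (A B : Matrix ι ι ℂ) : entrySum (A * B) ≤ entrySum A * entrySum B := by
  have h1 : ∀ a, ∑ b, ‖(A * B) a b‖ ≤ ∑ c, ‖A a c‖ * entrySum B := by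
    intro a
    calc ∑ b, ‖(A * B) a b‖ ≤ ∑ b, ∑ c, ‖A a c‖ * ‖B c b‖ := by
          refine Finset.sum_le_sum fun b _ => ?_
          rw [Matrix.mul_apply]
          exact (norm_sum_le _ _).trans_eq (Finset.sum_congr rfl fun c _ => norm_mul _ _)
      _ = ∑ c, ‖A a c‖ * ∑ b, ‖B c b‖ := by
          rw [Finset.sum_comm]
          exact Finset.sum_congr rfl fun c _ => (Finset.mul_sum _ _ _).symm
      _ ≤ ∑ c, ‖A a c‖ * entrySum B := Finset.sum_le_sum fun c _ =>
          mul_le_mul_of_nonneg_left (row_le_entrySum B c) (norm_nonneg _)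
  refine (Finset.sum_le_sum fun a _ => h1 a).trans_eq ?_
  simp only [entrySum, Finset.sum_mul]

theorem continuousAt_entrySum {P : ℂ → Matrix ι ι ℂ} {z : ℂ}
    (hP : ∀ a b, DifferentiableAt ℂ (fun z => P z a b) z) :
    ContinuousAt (fun z => entrySum (P z)) z := by
  simp only [entrySum]
  exact tendsto_finsetSum _ fun a _ => tendsto_finsetSum _ fun b _ =>
    (hP a b).continuousAt.norm

/-- The dependence on `P` and `P'` enters only through `κ`, so one majorant serves all nearby
spectral parameters. -/
theorem volterraBound_of_entrySum_le {ν : ι → ℂ} {P P' : Matrix ι ι ℂ} {B : ℝ → Matrix ι ι ℂ}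
    {κ : ℝ} (hB : ∀ i l, Continuous fun s => B s i l)
    (hBi : ∀ a i l, IntegrableOn (fun s => B s i l) (Set.Ioi a)) (hν : ∀ i, 0 ≤ (ν i).re)
    (hκ : entrySum P' * entrySum P ≤ κ) :
    VolterraBound ν (fun s => P' * B s * P) (fun s => κ * entrySum (B s)) where
  re_nonneg := hν
  continuous_kernel i l := by
    simp only [Matrix.mul_apply]
    exact continuous_finsetSum _ fun b _ => (continuous_finsetSum _ fun a _ =>
      continuous_const.mul (hB a b)).mul continuous_const
  continuous_bound := by
    simp only [entrySum]
    exact continuous_const.mul (continuous_finsetSum _ fun a _ =>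
      continuous_finsetSum _ fun b _ => (hB a b).norm)
  nonneg s := mul_nonneg
    ((mul_nonneg (entrySum_nonneg _) (entrySum_nonneg _)).trans hκ) (entrySum_nonneg _)
  integrableOn a := by
    simp only [entrySum]
    exact (integrable_finsetSum _ fun i _ => integrable_finsetSum _ fun l _ =>
      (hBi a i l).norm).const_mul κ
  le s i := by
    refine (row_le_entrySum _ i).trans ?_
    calc entrySum (P' * B s * P) ≤ entrySum P' * entrySum (B s) * entrySum P :=
          (entrySum_mul_le _ _).trans
            (mul_le_mul_of_nonneg_right (entrySum_mul_le _ _) (entrySum_nonneg _))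
      _ = entrySum P' * entrySum P * entrySum (B s) := by ring
      _ ≤ κ * entrySum (B s) := mul_le_mul_of_nonneg_right hκ (entrySum_nonneg _)

theorem norm_single_one_le {α : Type*} [DecidableEq α] (j i : α) :
    ‖(Pi.single j 1 : α → ℂ) i‖ ≤ 1 := by
  by_cases h : i = j
  · subst h; simp
  · simp [h]

/-- The set `S` need not be open: it will contain real boundary points, and the ordering of the real
parts is available only on `U ∩ S`. -/
theorem exists_nhds_volterraBound {μ : ℂ → ι → ℂ} {P P' : ℂ → Matrix ι ι ℂ}
    {B : ℝ → Matrix ι ι ℂ} {S : Set ℂ} (hB : ∀ i l, Continuous fun s => B s i l)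
    (hBi : ∀ a i l, IntegrableOn (fun s => B s i l) (Set.Ioi a)) (j : ι)
    (hμ : ∀ z ∈ S, ∀ i, (μ z j).re ≤ (μ z i).re) {z₀ : ℂ}
    (hP : ∀ a b, DifferentiableAt ℂ (fun z => P z a b) z₀)
    (hP' : ∀ a b, DifferentiableAt ℂ (fun z => P' z a b) z₀) :
    ∃ (U : Set ℂ) (m : ℝ → ℝ), IsOpen U ∧ z₀ ∈ U ∧ ∀ z ∈ U ∩ S,
      VolterraBound (fun i => μ z i - μ z j) (fun s => P' z * B s * P z) m := by
  have hc := (continuousAt_entrySum hP').mul (continuousAt_entrySum hP)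
  have hU := hc.eventually (gt_mem_nhds (lt_add_one (entrySum (P' z₀) * entrySum (P z₀))))
  obtain ⟨U, hUs, hUo, hzU⟩ := mem_nhds_iff.1 hU
  exact ⟨U, _, hUo, hzU, fun z hz => volterraBound_of_entrySum_le hB hBi
    (fun i => by simpa using hμ z hz.2 i) (le_of_lt (hUs hz.1))⟩

variable [DecidableEq ι]

/-- The Jost solution of `y' = (P diag μ P' + B) y` with
`y = exp (μ j x) (P e_j + o(1))` as `x → ∞`. -/
def jost (j : ι) (μ : ι → ℂ) (P P' : Matrix ι ι ℂ) (B : ℝ → Matrix ι ι ℂ) (x : ℝ) : ι → ℂ :=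
  Complex.exp (μ j * x) •
    P.mulVec (volterraSol (fun i => μ i - μ j) (fun s => P' * B s * P) (Pi.single j 1) x)

section Pointwise

variable {μ : ι → ℂ} {P P' : Matrix ι ι ℂ} {B : ℝ → Matrix ι ι ℂ}

/-- In the eigenbasis, `w = exp (-μ_j x) P' y` solves `w' = (diag μ - μ_j) w + P' B P w`, the
equation behind the Volterra series with `b = e_j`. -/
theorem hasDerivAt_jost (hP : P * P' = 1) (hB : ∀ i l, Continuous fun s => B s i l)
    (hBi : ∀ a i l, IntegrableOn (fun s => B s i l) (Set.Ioi a)) (j : ι)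
    (hμ : ∀ i, (μ j).re ≤ (μ i).re) (x : ℝ) (i : ι) :
    HasDerivAt (fun y => jost j μ P P' B y i)
      ((P * Matrix.diagonal μ * P' + B x).mulVec (jost j μ P P' B x) i) x := by
  have h := volterraBound_of_entrySum_le (ν := fun i => μ i - μ j) hB hBi
    (fun i => by simpa using hμ i) (le_refl (entrySum P' * entrySum P))
  have hν : ∀ i, (μ i - μ j) * (Pi.single j 1 : ι → ℂ) i = 0 := fun i => by
    by_cases hi : i = j
    · subst hi; simp
    · simp [hi]
  have hw := h.hasDerivAt_volterraSol (norm_single_one_le j) hν x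
  simp only [jost, Pi.smul_apply, smul_eq_mul]
  set w := volterraSol (fun i => μ i - μ j) (fun s => P' * B s * P) (Pi.single j 1)
  have he : HasDerivAt (fun y : ℝ => Complex.exp (μ j * y))
      (Complex.exp (μ j * x) * μ j) x := by
    simpa using ((hasDerivAt_id x).ofReal_comp.const_mul (μ j)).cexp
  have hPw : HasDerivAt (fun y => P.mulVec (w y) i)
      (P.mulVec (fun l => (μ l - μ j) * w x l + (P' * B x * P).mulVec (w x) l) i) x := by
    simp only [Matrix.mulVec, dotProduct]
    exact HasDerivAt.fun_sum fun l _ => (hw l).const_mul _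
  refine (he.mul hPw).congr_deriv ?_
  have hP' : P' * P = 1 := mul_eq_one_comm.1 hP
  have e1 : (fun l => (μ l - μ j) * w x l + (P' * B x * P).mulVec (w x) l)
      = (Matrix.diagonal μ).mulVec (w x) - μ j • w x + (P' * B x * P).mulVec (w x) := by
    funext l
    simp [Matrix.mulVec_diagonal]
    ring
  have e2 : P.mulVec ((P' * B x * P).mulVec (w x)) = (B x).mulVec (P.mulVec (w x)) := by
    rw [Matrix.mulVec_mulVec, Matrix.mulVec_mulVec, ← Matrix.mul_assoc, ← Matrix.mul_assoc, hP,
      Matrix.one_mul]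
  have e3 : (P * Matrix.diagonal μ * P').mulVec (P.mulVec (w x))
      = P.mulVec ((Matrix.diagonal μ).mulVec (w x)) := by
    rw [Matrix.mulVec_mulVec, Matrix.mulVec_mulVec, Matrix.mul_assoc, hP', Matrix.mul_one]
  rw [e1, Matrix.mulVec_smul, Matrix.add_mulVec, Matrix.mulVec_add, Matrix.mulVec_sub,
    Matrix.mulVec_smul, e2, e3]
  simp only [Pi.add_apply, Pi.sub_apply, Pi.smul_apply, smul_eq_mul]
  ring

theorem tendsto_jost (hB : ∀ i l, Continuous fun s => B s i l)
    (hBi : ∀ a i l, IntegrableOn (fun s => B s i l) (Set.Ioi a)) (j : ι)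
    (hμ : ∀ i, (μ j).re ≤ (μ i).re) (i : ι) :
    Tendsto (fun x : ℝ => Complex.exp (-(μ j * x)) * jost j μ P P' B x i) atTop (𝓝 (P i j)) := by
  have h := volterraBound_of_entrySum_le (ν := fun i => μ i - μ j) hB hBi
    (fun i => by simpa using hμ i) (le_refl (entrySum P' * entrySum P))
  have hw := h.tendsto_volterraSol (norm_single_one_le j)
  have hlim : P i j = P.mulVec (Pi.single j 1) i := by simp
  rw [hlim]
  have : ∀ x : ℝ, Complex.exp (-(μ j * x)) * jost j μ P P' B x i
      = P.mulVec (volterraSol (fun i => μ i - μ j) (fun s => P' * B s * P)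
          (Pi.single j 1) x) i := by
    intro x
    rw [jost, Pi.smul_apply, smul_eq_mul, ← mul_assoc, ← Complex.exp_add, neg_add_cancel,
      Complex.exp_zero, one_mul]
  simp only [this, Matrix.mulVec, dotProduct]
  exact tendsto_finsetSum _ fun l _ => (hw l).const_mul _

end Pointwise

section Parameter

variable {μ : ℂ → ι → ℂ} {P P' : ℂ → Matrix ι ι ℂ} {B : ℝ → Matrix ι ι ℂ} {S : Set ℂ}

theorem continuousOn_jost (hB : ∀ i l, Continuous fun s => B s i l)
    (hBi : ∀ a i l, IntegrableOn (fun s => B s i l) (Set.Ioi a)) (j : ι)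
    (hμ : ∀ z ∈ S, ∀ i, (μ z j).re ≤ (μ z i).re)
    (hμd : ∀ z ∈ S, ∀ i, DifferentiableAt ℂ (fun z => μ z i) z)
    (hP : ∀ z ∈ S, ∀ a b, DifferentiableAt ℂ (fun z => P z a b) z)
    (hP' : ∀ z ∈ S, ∀ a b, DifferentiableAt ℂ (fun z => P' z a b) z) (x : ℝ) (i : ι) :
    ContinuousOn (fun z => jost j (μ z) (P z) (P' z) B x i) S := by
  intro z₀ hz₀
  obtain ⟨U, m, hUo, hzU, hU⟩ := exists_nhds_volterraBound hB hBi j hμ (hP z₀ hz₀) (hP' z₀ hz₀)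
  have hc : ContinuousOn (fun z => jost j (μ z) (P z) (P' z) B x i) (U ∩ S) := by
    have cμ : ∀ i, ContinuousOn (fun z => μ z i) (U ∩ S) := fun i z hz =>
      (hμd z hz.2 i).continuousAt.continuousWithinAt
    have cP : ∀ a b, ContinuousOn (fun z => P z a b) (U ∩ S) := fun a b z hz =>
      (hP z hz.2 a b).continuousAt.continuousWithinAt
    have cP' : ∀ a b, ContinuousOn (fun z => P' z a b) (U ∩ S) := fun a b z hz =>
      (hP' z hz.2 a b).continuousAt.continuousWithinAt
    simp only [jost, Pi.smul_apply, smul_eq_mul, Matrix.mulVec, dotProduct]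
    refine (((cμ j).mul continuousOn_const).cexp).mul (continuousOn_finsetSum _ fun l _ =>
      (cP i l).mul (continuousOn_volterraSol hU (norm_single_one_le j)
        (fun i => (cμ i).sub (cμ j)) (fun s a b => ?_) x l))
    simp only [Matrix.mul_apply]
    exact continuousOn_finsetSum _ fun c _ => (continuousOn_finsetSum _ fun d _ =>
      (cP' a d).mul continuousOn_const).mul (cP c b)
  exact (hc z₀ ⟨hzU, hz₀⟩).mono_of_mem_nhdsWithin
    (inter_mem (mem_nhdsWithin_of_mem_nhds (hUo.mem_nhds hzU)) self_mem_nhdsWithin)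

theorem differentiableOn_jost (hS : IsOpen S) (hB : ∀ i l, Continuous fun s => B s i l)
    (hBi : ∀ a i l, IntegrableOn (fun s => B s i l) (Set.Ioi a)) (j : ι)
    (hμ : ∀ z ∈ S, ∀ i, (μ z j).re ≤ (μ z i).re)
    (hμd : ∀ z ∈ S, ∀ i, DifferentiableAt ℂ (fun z => μ z i) z)
    (hP : ∀ z ∈ S, ∀ a b, DifferentiableAt ℂ (fun z => P z a b) z)
    (hP' : ∀ z ∈ S, ∀ a b, DifferentiableAt ℂ (fun z => P' z a b) z) (x : ℝ) (i : ι) :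
    DifferentiableOn ℂ (fun z => jost j (μ z) (P z) (P' z) B x i) S := by
  intro z₀ hz₀
  obtain ⟨U, m, hUo, hzU, hU⟩ := exists_nhds_volterraBound hB hBi j hμ (hP z₀ hz₀) (hP' z₀ hz₀)
  have hc : DifferentiableOn ℂ (fun z => jost j (μ z) (P z) (P' z) B x i) (U ∩ S) := by
    have cμ : ∀ i, DifferentiableOn ℂ (fun z => μ z i) (U ∩ S) := fun i z hz =>
      (hμd z hz.2 i).differentiableWithinAt
    have cP : ∀ a b, DifferentiableOn ℂ (fun z => P z a b) (U ∩ S) := fun a b z hz =>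
      (hP z hz.2 a b).differentiableWithinAt
    have cP' : ∀ a b, DifferentiableOn ℂ (fun z => P' z a b) (U ∩ S) := fun a b z hz =>
      (hP' z hz.2 a b).differentiableWithinAt
    simp only [jost, Pi.smul_apply, smul_eq_mul, Matrix.mulVec, dotProduct]
    refine (((cμ j).mul (differentiableOn_const _)).cexp).mul (DifferentiableOn.fun_sum fun l _ =>
      (cP i l).mul (differentiableOn_volterraSol (hUo.inter hS) hU (norm_single_one_le j)
        (fun i => (cμ i).sub (cμ j)) (fun s a b => ?_) x l))
    simp only [Matrix.mul_apply]
    exact DifferentiableOn.fun_sum fun c _ => (DifferentiableOn.fun_sum fun d _ =>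
      (cP' a d).mul (differentiableOn_const _)).mul (cP c b)
  exact (hc.differentiableAt ((hUo.inter hS).mem_nhds ⟨hzU, hz₀⟩)).differentiableWithinAt

end Parameter

end

noncomputable section

/-! ### Fundamental matrices with prescribed asymptotics -/

theorem tendsto_matrix_zero_iff {α : Type*} {l : Filter ℝ} {F : ℝ → Matrix α α ℂ} :
    Tendsto F l (𝓝 0) ↔ ∀ i j, Tendsto (fun x => F x i j) l (𝓝 0) := by
  refine ⟨fun h i j => ?_, fun h => ?_⟩
  · exact ((continuous_id.matrix_elem i j).tendsto 0).comp h
  · exact tendsto_pi_nhds.2 fun i => tendsto_pi_nhds.2 fun j => h i j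

variable {ι : Type*} [Fintype ι]

theorem hasDerivAt_mul_entry {R Ψ : ℝ → Matrix ι ι ℂ} {R' Ψ' : Matrix ι ι ℂ} {x : ℝ}
    (hR : ∀ i j, HasDerivAt (fun y => R y i j) (R' i j) x)
    (hΨ : ∀ i j, HasDerivAt (fun y => Ψ y i j) (Ψ' i j) x) (i j : ι) :
    HasDerivAt (fun y => (R y * Ψ y) i j) ((R' * Ψ x + R x * Ψ') i j) x := by
  simp only [Matrix.mul_apply, Matrix.add_apply, ← Finset.sum_add_distrib]
  exact HasDerivAt.fun_sum fun k _ => (hR i k).mul (hΨ k j)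

/-- The terms `-R A Ψ` and `R A Ψ` cancel in the derivative of `R Ψ`. -/
theorem mul_eq_mul_of_hasDerivAt {A R Ψ : ℝ → Matrix ι ι ℂ}
    (hR : ∀ x i j, HasDerivAt (fun y => R y i j) (-(R x * A x) i j) x)
    (hΨ : ∀ x i j, HasDerivAt (fun y => Ψ y i j) ((A x * Ψ x) i j) x) (x y : ℝ) :
    R x * Ψ x = R y * Ψ y := by
  ext i j
  have h : ∀ x, HasDerivAt (fun y => (R y * Ψ y) i j) 0 x := by
    intro x
    refine (hasDerivAt_mul_entry (R' := -(R x * A x)) (hR x) (hΨ x) i j).congr_deriv ?_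
    rw [Matrix.neg_mul, Matrix.mul_assoc, neg_add_cancel, Matrix.zero_apply]
  exact is_const_of_deriv_eq_zero (fun x => (h x).differentiableAt) (fun x => (h x).deriv) x y

variable [DecidableEq ι]

/-- `Ψ` is a fundamental matrix of `Ψ' = A Ψ` with `Ψ = Θ + o(1)` along `l`, and `R` is its
inverse, which is bounded along `l`. -/
structure JostPair (A : ℝ → Matrix ι ι ℂ) (l : Filter ℝ) (Θ Ψ R : ℝ → Matrix ι ι ℂ) :
    Prop where
  hasDerivAt : ∀ x i j, HasDerivAt (fun y => Ψ y i j) ((A x * Ψ x) i j) x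
  hasDerivAt_dual : ∀ x i j, HasDerivAt (fun y => R y i j) (-(R x * A x) i j) x
  dual_mul : ∀ x, R x * Ψ x = 1
  tendsto : Tendsto (fun x => Ψ x - Θ x) l (𝓝 0)
  bounded : ∀ i j, ∃ c, ∀ᶠ x in l, ‖R x i j‖ ≤ c

namespace JostPair

variable {A : ℝ → Matrix ι ι ℂ} {l : Filter ℝ} {Θ Ψ R : ℝ → Matrix ι ι ℂ}

theorem mul_dual (h : JostPair A l Θ Ψ R) (x : ℝ) : Ψ x * R x = 1 :=
  mul_eq_one_comm.1 (h.dual_mul x)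

/-- The product `R (Φ - Ψ)` is constant, and it tends to 0 along `l` because `R` is bounded there;
`R` is invertible, so the difference vanishes. -/
theorem eq_of_tendsto [l.NeBot] (h : JostPair A l Θ Ψ R) {Φ : ℝ → Matrix ι ι ℂ}
    (hΦ : ∀ x i j, HasDerivAt (fun y => Φ y i j) ((A x * Φ x) i j) x)
    (hlim : Tendsto (fun x => Φ x - Θ x) l (𝓝 0)) : Φ = Ψ := by
  have hd : Tendsto (fun x => Φ x - Ψ x) l (𝓝 0) := by
    simpa using hlim.sub h.tendsto
  rw [tendsto_matrix_zero_iff] at hd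
  have hR : ∀ i j, Tendsto (fun x => (R x * (Φ x - Ψ x)) i j) l (𝓝 0) := by
    intro i j
    simp only [Matrix.mul_apply]
    rw [← Finset.sum_const_zero (s := Finset.univ (α := ι))]
    refine tendsto_finsetSum _ fun k _ => ?_
    obtain ⟨c, hc⟩ := h.bounded i k
    exact (hd k j).zero_mul_isBoundedUnder_le ⟨c, by simpa using hc⟩ |>.congr
      fun x => mul_comm _ _
  funext x
  have hconst : ∀ y, R y * (Φ y - Ψ y) = R x * (Φ x - Ψ x) := fun y => by
    rw [Matrix.mul_sub, Matrix.mul_sub, mul_eq_mul_of_hasDerivAt h.hasDerivAt_dual hΦ y x,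
      mul_eq_mul_of_hasDerivAt h.hasDerivAt_dual h.hasDerivAt y x]
  have h0 : R x * (Φ x - Ψ x) = 0 := by
    ext i j
    refine tendsto_nhds_unique (tendsto_const_nhds (f := l)) ((hR i j).congr fun y => ?_)
    rw [hconst y]
  have h1 := congrArg (Ψ x * ·) h0
  simp only [← Matrix.mul_assoc, h.mul_dual, Matrix.one_mul, Matrix.mul_zero] at h1
  exact sub_eq_zero.1 h1

/-- Serves to attach the time factor to Jost solutions normalized without it. -/
theorem mul_const (h : JostPair A l Θ Ψ R) {K K' : Matrix ι ι ℂ} (hK : K' * K = 1) :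
    JostPair A l (fun x => Θ x * K) (fun x => Ψ x * K) (fun x => K' * R x) where
  hasDerivAt x i j := by
    refine (hasDerivAt_mul_entry (R := Ψ) (Ψ := fun _ => K) (R' := A x * Ψ x) (Ψ' := 0)
      (h.hasDerivAt x) (fun i j => hasDerivAt_const x (K i j)) i j).congr_deriv ?_
    rw [Matrix.mul_zero, add_zero, Matrix.mul_assoc]
  hasDerivAt_dual x i j := by
    refine (hasDerivAt_mul_entry (R := fun _ => K') (Ψ := R) (R' := 0) (Ψ' := -(R x * A x))
      (fun i j => hasDerivAt_const x (K' i j)) (h.hasDerivAt_dual x) i j).congr_deriv ?_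
    rw [Matrix.zero_mul, zero_add, Matrix.mul_neg, Matrix.mul_assoc, Matrix.neg_apply]
  dual_mul x := by
    rw [Matrix.mul_assoc, ← Matrix.mul_assoc (R x), h.dual_mul, Matrix.one_mul, hK]
  tendsto := by
    have h1 := h.tendsto
    rw [tendsto_matrix_zero_iff] at h1 ⊢
    intro i j
    simp only [← Matrix.sub_mul]
    simp only [Matrix.mul_apply]
    rw [← Finset.sum_const_zero (s := Finset.univ (α := ι))]
    exact tendsto_finsetSum _ fun k _ => by simpa using (h1 i k).mul_const (K k j)
  bounded i j := by
    choose c hc using fun k => h.bounded k j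
    refine ⟨∑ k, ‖K' i k‖ * c k, ?_⟩
    filter_upwards [eventually_all.2 hc] with x hx
    rw [Matrix.mul_apply]
    refine norm_sum_le_of_le _ fun k _ => ?_
    rw [norm_mul]
    exact mul_le_mul_of_nonneg_left (hx k) (norm_nonneg _)

theorem comp_neg (h : JostPair A atTop Θ Ψ R) :
    JostPair (fun x => -A (-x)) atBot (fun x => Θ (-x)) (fun x => Ψ (-x)) (fun x => R (-x)) where
  hasDerivAt x i j := by
    have := (h.hasDerivAt (-x) i j).scomp x (hasDerivAt_neg x)
    refine this.congr_deriv ?_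
    simp
  hasDerivAt_dual x i j := by
    have := (h.hasDerivAt_dual (-x) i j).scomp x (hasDerivAt_neg x)
    refine this.congr_deriv ?_
    simp
  dual_mul x := h.dual_mul (-x)
  tendsto := h.tendsto.comp tendsto_neg_atBot_atTop
  bounded i j := by
    obtain ⟨c, hc⟩ := h.bounded i j
    exact ⟨c, tendsto_neg_atBot_atTop.eventually hc⟩

end JostPair

/-- The matrix whose columns are the Jost solutions at `+∞`. -/
def jostMatrix (μ : ι → ℂ) (P P' : Matrix ι ι ℂ) (B : ℝ → Matrix ι ι ℂ) (x : ℝ) :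
    Matrix ι ι ℂ :=
  Matrix.of fun i j => jost j μ P P' B x i

/-- The matrix whose rows are the Jost solutions at `+∞` of the adjoint system. -/
def jostDual (μ : ι → ℂ) (P P' : Matrix ι ι ℂ) (B : ℝ → Matrix ι ι ℂ) (x : ℝ) :
    Matrix ι ι ℂ :=
  Matrix.of fun i j => jost i (-μ) P'.transpose P.transpose (fun s => -(B s).transpose) x j

theorem norm_exp_mul_ofReal_eq_one {c : ℂ} (hc : c.re = 0) (x : ℝ) :
    ‖Complex.exp (c * x)‖ = 1 := by
  rw [Complex.norm_exp, Complex.re_mul_ofReal, hc, zero_mul, Real.exp_zero]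

/-- Imaginary eigenvalues make every index minimal, for `μ` as for `-μ`, so all columns of the
system and all rows of the adjoint system exist. -/
theorem jostPair_atTop {μ : ι → ℂ} {P P' : Matrix ι ι ℂ} {B : ℝ → Matrix ι ι ℂ}
    (hP : P * P' = 1) (hB : ∀ i l, Continuous fun s => B s i l)
    (hBi : ∀ a i l, IntegrableOn (fun s => B s i l) (Set.Ioi a)) (hμ : ∀ i, (μ i).re = 0) :
    JostPair (fun x => P * Matrix.diagonal μ * P' + B x) atTop
      (fun x => P * Matrix.diagonal fun j => Complex.exp (μ j * x))
      (jostMatrix μ P P' B) (jostDual μ P P' B) := by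
  have hP' : P' * P = 1 := mul_eq_one_comm.1 hP
  have hPt : P'.transpose * P.transpose = 1 := by
    rw [← Matrix.transpose_mul, hP, Matrix.transpose_one]
  have hBt : ∀ i l, Continuous fun s => (-(B s).transpose) i l := fun i l => (hB l i).neg
  have hBti : ∀ a i l, IntegrableOn (fun s => (-(B s).transpose) i l) (Set.Ioi a) :=
    fun a i l => (hBi a l i).neg
  have hμ' : ∀ i j, (μ i).re ≤ (μ j).re := fun i j => by rw [hμ, hμ]
  have hμn : ∀ i j, ((-μ) i).re ≤ ((-μ) j).re := fun i j => by simp [hμ]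
  have d1 : ∀ x i j, HasDerivAt (fun y => jostMatrix μ P P' B y i j)
      (((P * Matrix.diagonal μ * P' + B x) * jostMatrix μ P P' B x) i j) x := fun x i j =>
    hasDerivAt_jost hP hB hBi j (hμ' j) x i
  have d2 : ∀ x i j, HasDerivAt (fun y => jostDual μ P P' B y i j)
      (-(jostDual μ P P' B x * (P * Matrix.diagonal μ * P' + B x)) i j) x := by
    intro x i j
    refine (hasDerivAt_jost hPt hBt hBti i (hμn i) x j).congr_deriv ?_
    have : P'.transpose * Matrix.diagonal (-μ) * P.transpose + -(B x).transpose
        = -(P * Matrix.diagonal μ * P' + B x).transpose := by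
      rw [Matrix.transpose_add, Matrix.transpose_mul, Matrix.transpose_mul,
        Matrix.diagonal_transpose, Matrix.mul_assoc, neg_add]
      congr 1
      rw [show Matrix.diagonal (-μ) = -Matrix.diagonal μ from (Matrix.diagonal_neg μ).symm,
        Matrix.neg_mul, Matrix.mul_neg]
    rw [this]
    simp only [Matrix.mulVec, dotProduct, Matrix.mul_apply, ← Finset.sum_neg_distrib]
    refine Finset.sum_congr rfl fun k _ => ?_
    rw [Matrix.neg_apply, Matrix.transpose_apply, jostDual, Matrix.of_apply]
    ring
  have t1 : ∀ i j, Tendsto (fun x : ℝ => Complex.exp (-(μ j * x)) * jostMatrix μ P P' B x i j)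
      atTop (𝓝 (P i j)) := fun i j => tendsto_jost hB hBi j (hμ' j) i
  have t2 : ∀ i j, Tendsto (fun x : ℝ => Complex.exp (μ i * x) * jostDual μ P P' B x i j)
      atTop (𝓝 (P' i j)) := by
    intro i j
    have := tendsto_jost (P := P'.transpose) (P' := P.transpose) hBt hBti i (hμn i) j
    simp only [Pi.neg_apply, neg_mul, neg_neg, Matrix.transpose_apply] at this
    exact this
  refine ⟨d1, d2, fun x => ?_, ?_, fun i j => ?_⟩
  · have hconst := fun y => mul_eq_mul_of_hasDerivAt d2 d1 y x
    ext i j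
    -- The normalized product of rows and columns tends to `P' P = 1`, while `R Ψ` is constant. The
    -- leftover exponential has modulus 1, which forces the constant entry to equal that of the
    -- identity.
    have hlim : Tendsto (fun y : ℝ => Complex.exp ((μ i - μ j) * y) *
        ((jostDual μ P P' B x * jostMatrix μ P P' B x) i j - (1 : Matrix ι ι ℂ) i j))
        atTop (𝓝 0) := by
      have h1 : Tendsto (fun y : ℝ => ∑ k, (Complex.exp (μ i * y) * jostDual μ P P' B y i k) *
          (Complex.exp (-(μ j * y)) * jostMatrix μ P P' B y k j) - (1 : Matrix ι ι ℂ) i j)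
          atTop (𝓝 (∑ k, P' i k * P k j - (1 : Matrix ι ι ℂ) i j)) :=
        (tendsto_finsetSum _ fun k _ => (t2 i k).mul (t1 k j)).sub_const _
      rw [← Matrix.mul_apply, hP', sub_self] at h1
      refine h1.congr fun y => ?_
      have e1 : ∑ k, (Complex.exp (μ i * y) * jostDual μ P P' B y i k) *
          (Complex.exp (-(μ j * y)) * jostMatrix μ P P' B y k j)
          = Complex.exp ((μ i - μ j) * y) *
            (jostDual μ P P' B x * jostMatrix μ P P' B x) i j := by
        rw [← hconst y, Matrix.mul_apply, Finset.mul_sum]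
        refine Finset.sum_congr rfl fun k _ => ?_
        rw [sub_mul, sub_eq_add_neg, Complex.exp_add]
        ring
      have e2 : Complex.exp ((μ i - μ j) * y) * (1 : Matrix ι ι ℂ) i j
          = (1 : Matrix ι ι ℂ) i j := by
        by_cases hij : i = j
        · subst hij; simp
        · simp [hij]
      rw [e1, mul_sub, e2]
    have h2 := hlim.norm
    simp only [norm_mul, norm_zero] at h2
    have h3 : ∀ y : ℝ, ‖Complex.exp ((μ i - μ j) * y)‖ = 1 :=
      norm_exp_mul_ofReal_eq_one (by simp [hμ])
    simp only [h3, one_mul] at h2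
    exact sub_eq_zero.1 (norm_eq_zero.1 (tendsto_nhds_unique tendsto_const_nhds h2))
  · rw [tendsto_matrix_zero_iff]
    intro i j
    -- After taking norms, the unimodular factor `exp (μ_j x)` drops out and the normalized limit
    -- becomes an additive error.
    rw [tendsto_zero_iff_norm_tendsto_zero]
    have h1 := (tendsto_zero_iff_norm_tendsto_zero.1
      (by simpa using (t1 i j).sub_const (P i j)))
    refine h1.congr fun x => ?_
    rw [Matrix.sub_apply, Matrix.mul_diagonal]
    have : jostMatrix μ P P' B x i j - P i j * Complex.exp (μ j * x)
        = Complex.exp (μ j * x) *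
          (Complex.exp (-(μ j * x)) * jostMatrix μ P P' B x i j - P i j) := by
      rw [mul_sub, ← mul_assoc, ← Complex.exp_add, add_neg_cancel, Complex.exp_zero]
      ring
    rw [this, norm_mul, norm_exp_mul_ofReal_eq_one (hμ j), one_mul]
  · refine ⟨‖P' i j‖ + 1, ?_⟩
    filter_upwards [(t2 i j).norm.eventually (gt_mem_nhds (lt_add_one _))] with x hx
    rw [norm_mul, norm_exp_mul_ofReal_eq_one (hμ i), one_mul] at hx
    exact hx.le

/-- Under `x ↦ -x` the coefficient `A` becomes `-A(-x)`: the eigenvalues and the perturbation both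
change sign. -/
theorem jostPair_atBot {μ : ι → ℂ} {P P' : Matrix ι ι ℂ} {B : ℝ → Matrix ι ι ℂ}
    (hP : P * P' = 1) (hB : ∀ i l, Continuous fun s => B s i l)
    (hBi : ∀ a i l, IntegrableOn (fun s => B s i l) (Set.Iio a)) (hμ : ∀ i, (μ i).re = 0) :
    JostPair (fun x => P * Matrix.diagonal μ * P' + B x) atBot
      (fun x => P * Matrix.diagonal fun j => Complex.exp (μ j * x))
      (fun x => jostMatrix (-μ) P P' (fun s => -B (-s)) (-x))
      (fun x => jostDual (-μ) P P' (fun s => -B (-s)) (-x)) := by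
  have h := (jostPair_atTop (μ := -μ) (B := fun s => -B (-s)) hP
    (fun i l => ((hB i l).comp continuous_neg).neg)
    (fun a i l => by
      exact (hBi (-a) i l).comp_neg_Ioi.neg)
    (fun i => by simp [hμ])).comp_neg
  convert h using 2
  · rw [show Matrix.diagonal (-μ) = -Matrix.diagonal μ from (Matrix.diagonal_neg μ).symm]
    rw [Matrix.mul_neg, Matrix.neg_mul, neg_add, neg_neg, neg_neg, neg_neg]
  · simp

end

noncomputable section

namespace CoupledHirota

/-! ### The spectral problem of the coupled Hirota equations -/

/-- The eigenvalues `iλ, -ik, -iλ` of the asymptotic scattering problem. -/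
def eigenvalue (q₀ : ℝ) (z : ℂ) : Fin 3 → ℂ :=
  ![Complex.I * lam q₀ z, -(Complex.I * kk q₀ z), -(Complex.I * lam q₀ z)]

/-- The coefficients of `t` in the phases `iδ₁, iδ₂, -iδ₁`. -/
def timeRate (σ q₀ : ℝ) (z : ℂ) : Fin 3 → ℂ :=
  ![Complex.I * (2 * lam q₀ z * (kk q₀ z + σ * (3 * kk q₀ z ^ 2 - lam q₀ z ^ 2))),
    -(Complex.I * (lam q₀ z ^ 2 + kk q₀ z ^ 2 + 4 * σ * kk q₀ z ^ 3)),
    -(Complex.I * (2 * lam q₀ z * (kk q₀ z + σ * (3 * kk q₀ z ^ 2 - lam q₀ z ^ 2))))]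

/-- The time-dependent factor of `expPhase`. -/
def timeFactor (σ q₀ : ℝ) (z : ℂ) (t : ℝ) : Mat :=
  Matrix.diagonal fun i => Complex.exp (timeRate σ q₀ z i * t)

/-- The phases are linear in `x` and `t` separately, so time enters only through a constant right
factor. -/
theorem expPhase_eq (σ q₀ : ℝ) (z : ℂ) (x t : ℝ) :
    expPhase σ q₀ z x t
      = (Matrix.diagonal fun i => Complex.exp (eigenvalue q₀ z i * x)) * timeFactor σ q₀ z t := by
  rw [timeFactor, Matrix.diagonal_mul_diagonal, expPhase]
  congr 1
  funext i
  rw [← Complex.exp_add]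
  fin_cases i <;> simp [eigenvalue, timeRate, phase₁, phase₂] <;> congr 1 <;> ring

theorem timeFactor_neg_mul (σ q₀ : ℝ) (z : ℂ) (t : ℝ) :
    timeFactor σ q₀ z (-t) * timeFactor σ q₀ z t = 1 := by
  rw [timeFactor, timeFactor, Matrix.diagonal_mul_diagonal, ← Matrix.diagonal_one]
  congr 1
  funext i
  rw [← Complex.exp_add]
  simp

/-- The inverse of `Y q₀ w z` when `‖w‖ = q₀`. -/
def Yinv (q₀ : ℝ) (w : Vec) (z : ℂ) : Mat :=
  !![-(Complex.I * z ^ 2) / (z ^ 2 - (q₀ : ℂ) ^ 2),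
      Complex.I * z * star (w 0) / (z ^ 2 - (q₀ : ℂ) ^ 2),
      Complex.I * z * star (w 1) / (z ^ 2 - (q₀ : ℂ) ^ 2);
    0, w 1 / q₀, -w 0 / q₀;
    -(q₀ * z) / (z ^ 2 - (q₀ : ℂ) ^ 2),
      z ^ 2 * star (w 0) / (q₀ * (z ^ 2 - (q₀ : ℂ) ^ 2)),
      z ^ 2 * star (w 1) / (q₀ * (z ^ 2 - (q₀ : ℂ) ^ 2))]

/-- The set of spectral parameters at which `Y` is regular. -/
def regularSet (q₀ : ℝ) : Set ℂ := {z | z ≠ 0 ∧ z ^ 2 - (q₀ : ℂ) ^ 2 ≠ 0}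

theorem sum_conj_mul_self (w : Vec) :
    (starRingEnd ℂ) (w 0) * w 0 + (starRingEnd ℂ) (w 1) * w 1 = ((‖w‖ : ℝ) : ℂ) ^ 2 := by
  have h := EuclideanSpace.norm_sq_eq w
  rw [Fin.sum_univ_two] at h
  rw [← Complex.ofReal_pow, h, Complex.ofReal_add, Complex.ofReal_pow, Complex.ofReal_pow,
    ← Complex.conj_mul', ← Complex.conj_mul']

section Spectral

variable {q₀ : ℝ} {w : Vec} {z : ℂ}

theorem Yinv_mul_Y (hq₀ : q₀ ≠ 0) (hw : ‖w‖ = q₀) (hz : z ∈ regularSet q₀) :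
    Yinv q₀ w z * Y q₀ w z = 1 := by
  obtain ⟨h0, hd⟩ := hz
  have hq : (q₀ : ℂ) ≠ 0 := Complex.ofReal_ne_zero.2 hq₀
  have hs := sum_conj_mul_self w
  rw [hw] at hs
  have hI := Complex.I_sq
  -- Keeping the denominator atomic lets it be cleared; its definition returns through `hd'` in the
  -- final identities.
  generalize hd' : z ^ 2 - (q₀ : ℂ) ^ 2 = d at hd
  ext i j
  fin_cases i <;> fin_cases j <;>
    simp only [Yinv, Y, Matrix.mul_apply, Fin.sum_univ_three, hd'] <;>
    simp <;> field_simp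
  · linear_combination (-z ^ 2 + ((starRingEnd ℂ) (w 0) * w 0 + (starRingEnd ℂ) (w 1) * w 1)) * hI
      + hd' - hs
  · ring
  · linear_combination Complex.I * z * hs
  · ring
  · linear_combination hs
  · ring
  · linear_combination z * Complex.I * hs
  · ring
  · linear_combination z ^ 2 * hs + (q₀ : ℂ) ^ 2 * hd'

theorem X_mul_Y (hq₀ : q₀ ≠ 0) (hw : ‖w‖ = q₀) (hz : z ≠ 0) :
    X q₀ z w * Y q₀ w z = Y q₀ w z * Matrix.diagonal (eigenvalue q₀ z) := by
  have hq : (q₀ : ℂ) ≠ 0 := Complex.ofReal_ne_zero.2 hq₀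
  have hs := sum_conj_mul_self w
  rw [hw] at hs
  ext i j
  rw [Matrix.mul_diagonal]
  fin_cases i <;> fin_cases j <;>
    simp only [X, J, Q, Y, Matrix.mul_apply, Fin.sum_univ_three, eigenvalue, kk, lam] <;>
    simp <;> field_simp
  · linear_combination -2 * hs
  · ring
  · linear_combination -2 * z ^ 2 * hs
  all_goals ring

theorem Y_mul_Yinv (hq₀ : q₀ ≠ 0) (hw : ‖w‖ = q₀) (hz : z ∈ regularSet q₀) :
    Y q₀ w z * Yinv q₀ w z = 1 :=
  mul_eq_one_comm.1 (Yinv_mul_Y hq₀ hw hz)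

theorem Y_mul_diagonal_mul_Yinv (hq₀ : q₀ ≠ 0) (hw : ‖w‖ = q₀) (hz : z ∈ regularSet q₀) :
    Y q₀ w z * Matrix.diagonal (eigenvalue q₀ z) * Yinv q₀ w z = X q₀ z w := by
  rw [← X_mul_Y hq₀ hw hz.1, Matrix.mul_assoc, Y_mul_Yinv hq₀ hw hz, Matrix.mul_one]

theorem X_eq_add (q₀ : ℝ) (z : ℂ) (v w : Vec) :
    X q₀ z v = X q₀ z w + Complex.I • Q (v - w) := by
  have : Q v = Q w + Q (v - w) := by
    ext i j
    fin_cases i <;> fin_cases j <;> simp [Q] <;> ring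
  rw [X, this, smul_add, ← add_assoc, X]

theorem differentiableAt_Y (hz : z ∈ regularSet q₀) (a b : Fin 3) :
    DifferentiableAt ℂ (fun z => Y q₀ w z a b) z := by
  obtain ⟨h0, -⟩ := hz
  fin_cases a <;> fin_cases b <;> simp [Y] <;> fun_prop (disch := assumption)

theorem differentiableAt_Yinv (hq₀ : q₀ ≠ 0) (hz : z ∈ regularSet q₀) (a b : Fin 3) :
    DifferentiableAt ℂ (fun z => Yinv q₀ w z a b) z := by
  obtain ⟨h0, hd⟩ := hz
  have hq : (q₀ : ℂ) ≠ 0 := Complex.ofReal_ne_zero.2 hq₀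
  have hqd := mul_ne_zero hq hd
  fin_cases a <;> fin_cases b <;> simp [Yinv] <;> fun_prop (disch := assumption)

theorem differentiableAt_eigenvalue (hz : z ≠ 0) (a : Fin 3) :
    DifferentiableAt ℂ (fun z => eigenvalue q₀ z a) z := by
  fin_cases a <;> simp [eigenvalue, kk, lam] <;> fun_prop (disch := assumption)

theorem lam_im (q₀ : ℝ) (z : ℂ) :
    (lam q₀ z).im = z.im * (1 + q₀ ^ 2 / Complex.normSq z) / 2 := by
  have : (lam q₀ z).im = (z.im - ((q₀ : ℂ) ^ 2 / z).im) / 2 := by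
    rw [lam, show (2 : ℂ) = ((2 : ℝ) : ℂ) by norm_num, Complex.div_ofReal_im, Complex.sub_im]
  rw [this, ← Complex.ofReal_pow, div_eq_mul_inv _ z, Complex.im_ofReal_mul, Complex.inv_im]
  ring

theorem kk_im (q₀ : ℝ) (z : ℂ) :
    (kk q₀ z).im = z.im * (1 - q₀ ^ 2 / Complex.normSq z) / 2 := by
  have : (kk q₀ z).im = (z.im + ((q₀ : ℂ) ^ 2 / z).im) / 2 := by
    rw [kk, show (2 : ℂ) = ((2 : ℝ) : ℂ) by norm_num, Complex.div_ofReal_im, Complex.add_im]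
  rw [this, ← Complex.ofReal_pow, div_eq_mul_inv _ z, Complex.im_ofReal_mul, Complex.inv_im]
  ring

theorem eigenvalue_re (q₀ : ℝ) (z : ℂ) (i : Fin 3) :
    (eigenvalue q₀ z i).re = ![-(lam q₀ z).im, (kk q₀ z).im, (lam q₀ z).im] i := by
  fin_cases i <;> simp [eigenvalue]

/-- The claim is `-Im λ ≤ Im k ≤ Im λ`, because `Im λ + Im k = Im z` and `Im λ - Im k = q₀² Im z /
|z|²`. -/
theorem eigenvalue_re_le (q₀ : ℝ) (hz : 0 ≤ z.im) (i : Fin 3) :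
    (eigenvalue q₀ z 0).re ≤ (eigenvalue q₀ z i).re ∧
      (eigenvalue q₀ z i).re ≤ (eigenvalue q₀ z 2).re := by
  have hs : 0 ≤ z.im * (q₀ ^ 2 / Complex.normSq z) :=
    mul_nonneg hz (div_nonneg (sq_nonneg _) (Complex.normSq_nonneg z))
  simp only [eigenvalue_re, lam_im, kk_im]
  refine ⟨?_, ?_⟩ <;> fin_cases i <;> simp <;> linarith

theorem eigenvalue_re_ge (q₀ : ℝ) (hz : z.im ≤ 0) (i : Fin 3) :
    (eigenvalue q₀ z 2).re ≤ (eigenvalue q₀ z i).re ∧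
      (eigenvalue q₀ z i).re ≤ (eigenvalue q₀ z 0).re := by
  have hs : z.im * (q₀ ^ 2 / Complex.normSq z) ≤ 0 :=
    mul_nonpos_of_nonpos_of_nonneg hz (div_nonneg (sq_nonneg _) (Complex.normSq_nonneg z))
  simp only [eigenvalue_re, lam_im, kk_im]
  refine ⟨?_, ?_⟩ <;> fin_cases i <;> simp <;> linarith

theorem eigenvalue_re_eq_zero (q₀ z : ℝ) (i : Fin 3) : (eigenvalue q₀ z i).re = 0 := by
  simp only [eigenvalue_re, lam_im, kk_im]
  fin_cases i <;> simp

theorem mem_regularSet_of_im_ne_zero (hz : z.im ≠ 0) : z ∈ regularSet q₀ := by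
  refine ⟨fun h => hz (by simp [h]), fun h => hz ?_⟩
  rcases sq_eq_sq_iff_eq_or_eq_neg.1 (sub_eq_zero.1 h) with h | h <;> simp [h]

theorem ofReal_mem_regularSet {x : ℝ} (hx : x ∈ spectrumSet q₀) : (x : ℂ) ∈ regularSet q₀ := by
  obtain ⟨h0, h1, h2⟩ := hx
  refine ⟨Complex.ofReal_ne_zero.2 h0, fun h => ?_⟩
  rcases sq_eq_sq_iff_eq_or_eq_neg.1 (sub_eq_zero.1 h) with h | h
  · exact h1 (Complex.ofReal_injective h)
  · exact h2 (Complex.ofReal_injective (by rw [h, Complex.ofReal_neg]))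

end Spectral

end CoupledHirota

end

noncomputable section

/-! ### Ratios of fundamental matrices -/

section Ratio

variable {ι : Type*} [Fintype ι] [DecidableEq ι]

theorem JostPair.eq_mul {A Θ₁ Ψ₁ R₁ Θ₂ Ψ₂ R₂ : ℝ → Matrix ι ι ℂ} {l₁ l₂ : Filter ℝ}
    (h₁ : JostPair A l₁ Θ₁ Ψ₁ R₁) (h₂ : JostPair A l₂ Θ₂ Ψ₂ R₂) (x y : ℝ) :
    Ψ₂ x = Ψ₁ x * (R₁ y * Ψ₂ y) := by
  rw [← mul_eq_mul_of_hasDerivAt h₁.hasDerivAt_dual h₂.hasDerivAt x y, ← Matrix.mul_assoc,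
    h₁.mul_dual, Matrix.one_mul]

theorem JostPair.eq_mul_iff {A Θ₁ Ψ₁ R₁ Θ₂ Ψ₂ R₂ : ℝ → Matrix ι ι ℂ} {l₁ l₂ : Filter ℝ}
    (h₁ : JostPair A l₁ Θ₁ Ψ₁ R₁) (h₂ : JostPair A l₂ Θ₂ Ψ₂ R₂) (y : ℝ) {G : Matrix ι ι ℂ} :
    (∀ x, Ψ₂ x = Ψ₁ x * G) ↔ G = R₁ y * Ψ₂ y := by
  constructor
  · intro h
    rw [h y, ← Matrix.mul_assoc, h₁.dual_mul, Matrix.one_mul]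
  · rintro rfl x
    exact h₁.eq_mul h₂ x y

theorem JostPair.ratio_mul_ratio {A Θ₁ Ψ₁ R₁ Θ₂ Ψ₂ R₂ : ℝ → Matrix ι ι ℂ} {l₁ l₂ : Filter ℝ}
    (h₁ : JostPair A l₁ Θ₁ Ψ₁ R₁) (h₂ : JostPair A l₂ Θ₂ Ψ₂ R₂) (x : ℝ) :
    (R₂ x * Ψ₁ x) * (R₁ x * Ψ₂ x) = 1 := by
  rw [Matrix.mul_assoc, ← Matrix.mul_assoc (Ψ₁ x), h₁.mul_dual, Matrix.one_mul, h₂.dual_mul]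

theorem differentiableAt_det {Ψ : ℝ → Matrix ι ι ℂ} {x : ℝ}
    (h : ∀ i j, DifferentiableAt ℝ (fun y => Ψ y i j) x) :
    DifferentiableAt ℝ (fun y => (Ψ y).det) x := by
  simp only [Matrix.det_apply]
  exact DifferentiableAt.fun_sum fun σ _ =>
    (DifferentiableAt.fun_finsetProd fun i _ => h (σ i) i).const_smul _

theorem differentiableAt_inv_entry {Ψ : ℝ → Matrix ι ι ℂ} {x : ℝ}
    (h : ∀ i j, DifferentiableAt ℝ (fun y => Ψ y i j) x) (hu : IsUnit (Ψ x)) (i j : ι) :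
    DifferentiableAt ℝ (fun y => (Ψ y)⁻¹ i j) x := by
  simp only [Matrix.inv_def, Ring.inverse_eq_inv', Matrix.smul_apply, smul_eq_mul,
    Matrix.adjugate_apply]
  refine ((differentiableAt_det h).inv ((Matrix.isUnit_iff_isUnit_det _).1 hu).ne_zero).mul
    (differentiableAt_det fun a b => ?_)
  by_cases ha : a = j
  · subst ha
    simp
  · simpa [Matrix.updateRow_ne ha] using h a b

/-- Used in the time direction, where no adjoint solution has been constructed: the inverse itself
satisfies the adjoint equation, by differentiating `Φ⁻¹ Φ = 1`. -/
theorem inv_mul_eq_inv_mul_of_hasDerivAt {A Φ Ψ : ℝ → Matrix ι ι ℂ} (hu : ∀ x, IsUnit (Φ x))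
    (hΦ : ∀ x i j, HasDerivAt (fun y => Φ y i j) ((A x * Φ x) i j) x)
    (hΨ : ∀ x i j, HasDerivAt (fun y => Ψ y i j) ((A x * Ψ x) i j) x) (x y : ℝ) :
    (Φ x)⁻¹ * Ψ x = (Φ y)⁻¹ * Ψ y := by
  have hdet : ∀ x, IsUnit (Φ x).det := fun x => (Matrix.isUnit_iff_isUnit_det _).1 (hu x)
  refine mul_eq_mul_of_hasDerivAt (A := A) (R := fun y => (Φ y)⁻¹) (fun x => ?_) hΨ x y
  set D : Matrix ι ι ℂ := Matrix.of fun i j => deriv (fun y => (Φ y)⁻¹ i j) x with hD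
  have hR : ∀ i j, HasDerivAt (fun y => (Φ y)⁻¹ i j) (D i j) x := fun i j =>
    (differentiableAt_inv_entry (fun a b => (hΦ x a b).differentiableAt) (hu x) i j).hasDerivAt
  have h0 : D * Φ x + (Φ x)⁻¹ * (A x * Φ x) = 0 := by
    ext i j
    refine (hasDerivAt_mul_entry hR (hΦ x) i j).unique ?_
    have : (fun y => ((Φ y)⁻¹ * Φ y) i j) = fun _ => (1 : Matrix ι ι ℂ) i j := by
      funext y
      rw [Matrix.nonsing_inv_mul _ (hdet y)]
    rw [this]
    exact hasDerivAt_const _ _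
  have h1 := congrArg (· * (Φ x)⁻¹) h0
  simp only [Matrix.add_mul, Matrix.mul_assoc, Matrix.mul_nonsing_inv _ (hdet x),
    Matrix.mul_one, Matrix.zero_mul] at h1
  intro i j
  have h2 := hR i j
  rw [eq_neg_of_add_eq_zero_left h1] at h2
  exact h2

end Ratio

/-! ### The scattering matrix and the analytic continuation of its diagonal entries -/

namespace CoupledHirota

/-- The deviation of the scattering problem from its asymptotic form. -/
def potential (u : ℝ → Vec) (w : Vec) (s : ℝ) : Mat := Complex.I • Q (u s - w)

theorem norm_potential_le (u : ℝ → Vec) (w : Vec) (s : ℝ) (i j : Fin 3) :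
    ‖potential u w s i j‖ ≤ ‖u s - w‖ := by
  have h := fun k => PiLp.norm_apply_le (u s - w) k
  have h0 := h 0
  have h1 := h 1
  have h2 := norm_nonneg (u s - w)
  rw [potential, Matrix.smul_apply, norm_smul, Complex.norm_I, one_mul]
  generalize u s - w = v at *
  fin_cases i <;> fin_cases j <;> simp [Q] <;> assumption

theorem continuous_potential {u : ℝ → Vec} (hu : Continuous u) (w : Vec) (i j : Fin 3) :
    Continuous fun s => potential u w s i j := by
  have h : ∀ k, Continuous fun s => (u s - w) k := fun k =>
    (EuclideanSpace.proj k : Vec →L[ℂ] ℂ).continuous.comp (hu.sub continuous_const)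
  have h0 := h 0
  have h1 := h 1
  simp only [potential, Matrix.smul_apply, smul_eq_mul]
  refine continuous_const.mul ?_
  fin_cases i <;> fin_cases j
  · exact continuous_const
  · exact (continuous_star.comp h0).neg
  · exact (continuous_star.comp h1).neg
  · exact h0
  · exact continuous_const
  · exact continuous_const
  · exact h1
  · exact continuous_const
  · exact continuous_const

theorem integrableOn_potential {u : ℝ → Vec} (hu : Continuous u) {w : Vec} {s : Set ℝ}
    (h : IntegrableOn (fun x => u x - w) s) (i j : Fin 3) :
    IntegrableOn (fun x => potential u w x i j) s :=
  h.norm.mono' (continuous_potential hu w i j).aestronglyMeasurable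
    (ae_of_all _ fun x => norm_potential_le u w x i j)

theorem X_eq_diagonalization {q₀ : ℝ} (hq₀ : q₀ ≠ 0) {w : Vec} (hw : ‖w‖ = q₀) {z : ℂ}
    (hz : z ∈ regularSet q₀) (u : ℝ → Vec) :
    (fun x => Y q₀ w z * Matrix.diagonal (eigenvalue q₀ z) * Yinv q₀ w z + potential u w x)
      = fun x => X q₀ z (u x) := by
  funext x
  rw [Y_mul_diagonal_mul_Yinv hq₀ hw hz, X_eq_add q₀ z (u x) w, potential]

theorem jostPair_plus {q₀ : ℝ} (hq₀ : q₀ ≠ 0) {w : Vec} (hw : ‖w‖ = q₀) {u : ℝ → Vec}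
    (hu : Continuous u) (hi : ∀ a, IntegrableOn (fun x => u x - w) (Set.Ioi a))
    {z : ℝ} (hz : z ∈ spectrumSet q₀) (σ t : ℝ) :
    JostPair (fun x => X q₀ z (u x)) atTop (fun x => Y q₀ w z * expPhase σ q₀ z x t)
      (fun x => jostMatrix (eigenvalue q₀ z) (Y q₀ w z) (Yinv q₀ w z) (potential u w) x *
        timeFactor σ q₀ z t)
      (fun x => timeFactor σ q₀ z (-t) *
        jostDual (eigenvalue q₀ z) (Y q₀ w z) (Yinv q₀ w z) (potential u w) x) := by
  have hr := ofReal_mem_regularSet hz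
  have h := (jostPair_atTop (Y_mul_Yinv hq₀ hw hr) (continuous_potential hu w)
    (fun a => integrableOn_potential hu (hi a)) (eigenvalue_re_eq_zero q₀ z)).mul_const
    (timeFactor_neg_mul σ q₀ z t)
  rw [X_eq_diagonalization hq₀ hw hr] at h
  simpa only [Matrix.mul_assoc, ← expPhase_eq] using h

theorem jostPair_minus {q₀ : ℝ} (hq₀ : q₀ ≠ 0) {w : Vec} (hw : ‖w‖ = q₀) {u : ℝ → Vec}
    (hu : Continuous u) (hi : ∀ a, IntegrableOn (fun x => u x - w) (Set.Iio a))
    {z : ℝ} (hz : z ∈ spectrumSet q₀) (σ t : ℝ) :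
    JostPair (fun x => X q₀ z (u x)) atBot (fun x => Y q₀ w z * expPhase σ q₀ z x t)
      (fun x => jostMatrix (-eigenvalue q₀ z) (Y q₀ w z) (Yinv q₀ w z)
        (fun s => -potential u w (-s)) (-x) * timeFactor σ q₀ z t)
      (fun x => timeFactor σ q₀ z (-t) * jostDual (-eigenvalue q₀ z) (Y q₀ w z) (Yinv q₀ w z)
        (fun s => -potential u w (-s)) (-x)) := by
  have hr := ofReal_mem_regularSet hz
  have h := (jostPair_atBot (Y_mul_Yinv hq₀ hw hr) (continuous_potential hu w)
    (fun a => integrableOn_potential hu (hi a)) (eigenvalue_re_eq_zero q₀ z)).mul_const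
    (timeFactor_neg_mul σ q₀ z t)
  rw [X_eq_diagonalization hq₀ hw hr] at h
  simpa only [Matrix.mul_assoc, ← expPhase_eq] using h

/-- Conjugation by a diagonal matrix preserves diagonal entries, so the time factors do not affect
the continuation. -/
theorem timeFactor_conj_apply (σ q₀ : ℝ) (z : ℂ) (t : ℝ) (A B : Mat) (j : Fin 3) :
    ((timeFactor σ q₀ z (-t) * A) * (B * timeFactor σ q₀ z t)) j j = ∑ k, A j k * B k j := by
  rw [Matrix.mul_assoc, ← Matrix.mul_assoc A, timeFactor, timeFactor, Matrix.diagonal_mul,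
    Matrix.mul_diagonal, Matrix.mul_apply, mul_comm, mul_assoc, ← Complex.exp_add]
  simp

/-- Sums of products of components of Jost solutions extend analytically to the region where the
exponential growth of the selected component is minimal. -/
theorem extendsAnalytically_sum_jost {q₀ : ℝ} (hq₀ : q₀ ≠ 0) {w₁ w₂ : Vec} {D : Set ℂ}
    (hD : IsOpen D) (hDr : D ⊆ regularSet q₀) {B₁ B₂ : ℝ → Mat}
    (hB₁ : ∀ i l, Continuous fun s => B₁ s i l) (hB₂ : ∀ i l, Continuous fun s => B₂ s i l)
    (hi₁ : ∀ a i l, IntegrableOn (fun s => B₁ s i l) (Set.Ioi a))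
    (hi₂ : ∀ a i l, IntegrableOn (fun s => B₂ s i l) (Set.Ioi a))
    {μ : ℂ → Fin 3 → ℂ} (hμd : ∀ z ∈ regularSet q₀, ∀ i, DifferentiableAt ℂ (fun z => μ z i) z)
    {j : Fin 3} (hμ : ∀ z ∈ D ∪ Complex.ofReal '' spectrumSet q₀, ∀ i, (μ z j).re ≤ (μ z i).re)
    {f : ℝ → ℂ}
    (hf : ∀ z ∈ spectrumSet q₀, f z =
      ∑ k, jost j (μ z) (Yinv q₀ w₁ z).transpose (Y q₀ w₁ z).transpose B₁ 0 k *
        jost j (μ z) (Y q₀ w₂ z) (Yinv q₀ w₂ z) B₂ 0 k) :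
    ExtendsAnalytically f (spectrumSet q₀) D := by
  have hr : ∀ z ∈ D ∪ Complex.ofReal '' spectrumSet q₀, z ∈ regularSet q₀ := by
    rintro z (hz | ⟨x, hx, rfl⟩)
    · exact hDr hz
    · exact ofReal_mem_regularSet hx
  refine ⟨fun z => ∑ k, jost j (μ z) (Yinv q₀ w₁ z).transpose (Y q₀ w₁ z).transpose B₁ 0 k *
    jost j (μ z) (Y q₀ w₂ z) (Yinv q₀ w₂ z) B₂ 0 k, ?_, ?_, fun z hz => (hf z hz).symm⟩
  · refine DifferentiableOn.analyticOnNhd (DifferentiableOn.fun_sum fun k _ => ?_) hD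
    exact (differentiableOn_jost hD hB₁ hi₁ j (fun z hz => hμ z (Or.inl hz))
      (fun z hz => hμd z (hDr hz)) (fun z hz a b => differentiableAt_Yinv hq₀ (hDr hz) b a)
      (fun z hz a b => differentiableAt_Y (hDr hz) b a) 0 k).mul
      (differentiableOn_jost hD hB₂ hi₂ j (fun z hz => hμ z (Or.inl hz))
      (fun z hz => hμd z (hDr hz)) (fun z hz => differentiableAt_Y (hDr hz))
      (fun z hz => differentiableAt_Yinv hq₀ (hDr hz)) 0 k)
  · refine continuousOn_finsetSum _ fun k _ => ?_
    exact (continuousOn_jost hB₁ hi₁ j hμ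
      (fun z hz => hμd z (hr z hz)) (fun z hz a b => differentiableAt_Yinv hq₀ (hr z hz) b a)
      (fun z hz a b => differentiableAt_Y (hr z hz) b a) 0 k).mul
      (continuousOn_jost hB₂ hi₂ j hμ
      (fun z hz => hμd z (hr z hz)) (fun z hz => differentiableAt_Y (hr z hz))
      (fun z hz => differentiableAt_Yinv hq₀ (hr z hz)) 0 k)

/-- The scattering matrix of the potential `u` with boundary values `wm`, `wp`. -/
def scatteringMatrix (σ q₀ : ℝ) (u : ℝ → Vec) (wm wp : Vec) (t : ℝ) (z : ℂ) : Mat :=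
  (timeFactor σ q₀ z (-t) * jostDual (-eigenvalue q₀ z) (Y q₀ wm z) (Yinv q₀ wm z)
    (fun s => -potential u wm (-s)) (-0)) *
  (jostMatrix (eigenvalue q₀ z) (Y q₀ wp z) (Yinv q₀ wp z) (potential u wp) 0 *
    timeFactor σ q₀ z t)

/-- The explicit inverse of `scatteringMatrix`. -/
def scatteringMatrixInv (σ q₀ : ℝ) (u : ℝ → Vec) (wm wp : Vec) (t : ℝ) (z : ℂ) : Mat :=
  (timeFactor σ q₀ z (-t) *
    jostDual (eigenvalue q₀ z) (Y q₀ wp z) (Yinv q₀ wp z) (potential u wp) 0) *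
  (jostMatrix (-eigenvalue q₀ z) (Y q₀ wm z) (Yinv q₀ wm z)
    (fun s => -potential u wm (-s)) (-0) * timeFactor σ q₀ z t)

section Extension

variable {q₀ : ℝ} {wm wp : Vec} {u : ℝ → Vec} {D : Set ℂ} {j : Fin 3}

/-- The dual solution at `-∞` carries two sign changes of `μ`, from reflection and from the adjoint.
Both factors thus have eigenvalues `μ` and require `Re μ_j` minimal. -/
theorem extendsAnalytically_scatteringMatrix (hq₀ : q₀ ≠ 0) (hu : Continuous u)
    (him : ∀ a, IntegrableOn (fun x => u x - wm) (Set.Iio a))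
    (hip : ∀ a, IntegrableOn (fun x => u x - wp) (Set.Ioi a)) (σ t : ℝ)
    (hD : IsOpen D) (hDr : D ⊆ regularSet q₀)
    (hμ : ∀ z ∈ D ∪ Complex.ofReal '' spectrumSet q₀, ∀ i,
      (eigenvalue q₀ z j).re ≤ (eigenvalue q₀ z i).re) :
    ExtendsAnalytically (fun z => scatteringMatrix σ q₀ u wm wp t z j j) (spectrumSet q₀) D := by
  refine extendsAnalytically_sum_jost hq₀ (w₁ := wm) (w₂ := wp) hD hDr (μ := eigenvalue q₀)
    (B₁ := fun s => (potential u wm (-s)).transpose)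
    (fun i l => (continuous_potential hu wm l i).comp continuous_neg) (continuous_potential hu wp)
    (fun a i l => (integrableOn_potential hu (him (-a)) l i).comp_neg_Ioi)
    (fun a => integrableOn_potential hu (hip a))
    (fun z hz => differentiableAt_eigenvalue hz.1) hμ fun z _ => ?_
  rw [scatteringMatrix, timeFactor_conj_apply]
  simp [jostDual, jostMatrix]

/-- Each factor now carries a single sign change, the row at `+∞` from the adjoint and the column at
`-∞` from reflection, so `Re μ_j` must be maximal. -/
theorem extendsAnalytically_scatteringMatrixInv (hq₀ : q₀ ≠ 0) (hu : Continuous u)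
    (him : ∀ a, IntegrableOn (fun x => u x - wm) (Set.Iio a))
    (hip : ∀ a, IntegrableOn (fun x => u x - wp) (Set.Ioi a)) (σ t : ℝ)
    (hD : IsOpen D) (hDr : D ⊆ regularSet q₀)
    (hμ : ∀ z ∈ D ∪ Complex.ofReal '' spectrumSet q₀, ∀ i,
      (eigenvalue q₀ z i).re ≤ (eigenvalue q₀ z j).re) :
    ExtendsAnalytically (fun z => scatteringMatrixInv σ q₀ u wm wp t z j j)
      (spectrumSet q₀) D := by
  refine extendsAnalytically_sum_jost hq₀ (w₁ := wp) (w₂ := wm) hD hDr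
    (μ := fun z => -eigenvalue q₀ z)
    (B₁ := fun s => -(potential u wp s).transpose) (B₂ := fun s => -potential u wm (-s))
    (fun i l => (continuous_potential hu wp l i).neg)
    (fun i l => ((continuous_potential hu wm i l).comp continuous_neg).neg)
    (fun a i l => (integrableOn_potential hu (hip a) l i).neg)
    (fun a i l => (integrableOn_potential hu (him (-a)) i l).comp_neg_Ioi.neg)
    (fun z hz i => (differentiableAt_eigenvalue hz.1 i).neg)
    (fun z hz i => by simpa using hμ z hz i) fun z _ => ?_
  rw [scatteringMatrixInv, timeFactor_conj_apply]
  simp [jostDual, jostMatrix]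

end Extension

theorem extendsAnalytically_congr {f g : ℝ → ℂ} {E : Set ℝ} {D : Set ℂ}
    (h : ExtendsAnalytically f E D) (hfg : ∀ z ∈ E, f z = g z) : ExtendsAnalytically g E D := by
  obtain ⟨F, h1, h2, h3⟩ := h
  exact ⟨F, h1, h2, fun z hz => (h3 z hz).trans (hfg z hz)⟩

theorem isOpen_Dplus : IsOpen Dplus := isOpen_lt continuous_const Complex.continuous_im

theorem isOpen_Dminus : IsOpen Dminus := isOpen_lt Complex.continuous_im continuous_const

theorem im_nonneg_of_mem {E : Set ℝ} {z : ℂ} (hz : z ∈ Dplus ∪ Complex.ofReal '' E) :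
    0 ≤ z.im := by
  rcases hz with hz | ⟨x, -, rfl⟩
  · exact le_of_lt hz
  · simp

theorem im_nonpos_of_mem {E : Set ℝ} {z : ℂ} (hz : z ∈ Dminus ∪ Complex.ofReal '' E) :
    z.im ≤ 0 := by
  rcases hz with hz | ⟨x, -, rfl⟩
  · exact le_of_lt hz
  · simp

theorem isJost_iff_eq {σ q₀ : ℝ} {q : ℝ → ℝ → Vec} {l : Filter ℝ} [l.NeBot] {w : Vec} {t z : ℝ}
    {Ψ R : ℝ → Mat}
    (h : JostPair (fun x => X q₀ z (q x t)) l (fun x => Y q₀ w z * expPhase σ q₀ z x t) Ψ R)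
    (Φ : ℝ → Mat) : IsJost σ q₀ q l w t z Φ ↔ Φ = Ψ := by
  refine ⟨fun hΦ => h.eq_of_tendsto hΦ.1 hΦ.2, ?_⟩
  rintro rfl
  exact ⟨h.hasDerivAt, h.tendsto⟩

end CoupledHirota

end

/-! ### Existence, time independence and analyticity of the scattering data -/

open CoupledHirota
theorem theorem2 (σ : ℝ) (v₀ : Vec) (hv₀ : v₀ ≠ 0) (δm δp : ℝ) (qm qp : Vec)
    (hqm : qm = Complex.exp (Complex.I * δm) • v₀)
    (hqp : qp = Complex.exp (Complex.I * δp) • v₀)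
    (q : ℝ → ℝ → Vec) (hq : IsHirotaSolution σ ‖v₀‖ q)
    (hlim_m : ∀ t, Tendsto (fun x => q x t) atBot (𝓝 qm))
    (hlim_p : ∀ t, Tendsto (fun x => q x t) atTop (𝓝 qp))
    (hint_m : ∀ t a : ℝ, IntegrableOn (fun x => q x t - qm) (Set.Iio a) volume)
    (hint_p : ∀ t a : ℝ, IntegrableOn (fun x => q x t - qp) (Set.Ioi a) volume) :
    ∃ H : ℝ → ℝ → Mat,
      -- the Jost solutions and the scattering matrix `H t z` are well defined
      (∀ t : ℝ, ∀ z ∈ spectrumSet ‖v₀‖,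
        (∃! Ψ, IsJost σ ‖v₀‖ q atBot qm t z Ψ) ∧
        (∃! Ψ, IsJost σ ‖v₀‖ q atTop qp t z Ψ) ∧
        (∀ G, IsScatteringMatrix σ ‖v₀‖ q qm qp t z G ↔ G = H t z) ∧
        IsUnit (H t z)) ∧
      -- it is the `x, t`-independent scattering matrix of simultaneous Jost solutions
      (∀ z ∈ spectrumSet ‖v₀‖, ∀ Ψm Ψp : ℝ → ℝ → Mat,
        IsLaxJost σ ‖v₀‖ q atBot qm z Ψm → IsLaxJost σ ‖v₀‖ q atTop qp z Ψp →
        ∀ s x t : ℝ, Ψp x t = Ψm x t * H s z) ∧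
      -- analyticity of the scattering coefficients, with `S = H⁻¹`
      ∀ t : ℝ,
        ExtendsAnalytically (fun z => (H t z)⁻¹ 2 2) (spectrumSet ‖v₀‖) Dplus ∧
        ExtendsAnalytically (fun z => H t z 0 0) (spectrumSet ‖v₀‖) Dplus ∧
        ExtendsAnalytically (fun z => (H t z)⁻¹ 0 0) (spectrumSet ‖v₀‖) Dminus ∧
        ExtendsAnalytically (fun z => H t z 2 2) (spectrumSet ‖v₀‖) Dminus := by
  have hq₀ : ‖v₀‖ ≠ 0 := norm_ne_zero_iff.2 hv₀
  have hphase : ∀ δ : ℝ, ‖Complex.exp (Complex.I * δ) • v₀‖ = ‖v₀‖ := fun δ => by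
    rw [norm_smul, norm_exp_mul_ofReal_eq_one Complex.I_re, one_mul]
  have hwm : ‖qm‖ = ‖v₀‖ := by rw [hqm, hphase]
  have hwp : ‖qp‖ = ‖v₀‖ := by rw [hqp, hphase]
  have hc : ∀ t, Continuous fun x => q x t := fun t => (hq.contDiff_x t).continuous
  have pm := fun t {z : ℝ} (hz : z ∈ spectrumSet ‖v₀‖) =>
    jostPair_minus hq₀ hwm (hc t) (hint_m t) hz σ t
  have pp := fun t {z : ℝ} (hz : z ∈ spectrumSet ‖v₀‖) =>
    jostPair_plus hq₀ hwp (hc t) (hint_p t) hz σ t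
  have hinv : ∀ t, ∀ z ∈ spectrumSet ‖v₀‖,
      scatteringMatrixInv σ ‖v₀‖ (fun x => q x t) qm qp t z *
        scatteringMatrix σ ‖v₀‖ (fun x => q x t) qm qp t z = 1 := fun t z hz =>
    (pm t hz).ratio_mul_ratio (pp t hz) 0
  have hS : ∀ t, ∀ z ∈ spectrumSet ‖v₀‖,
      scatteringMatrixInv σ ‖v₀‖ (fun x => q x t) qm qp t z =
        (scatteringMatrix σ ‖v₀‖ (fun x => q x t) qm qp t z)⁻¹ := fun t z hz =>
    (Matrix.inv_eq_left_inv (hinv t z hz)).symm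
  have hDp : Dplus ⊆ regularSet ‖v₀‖ := fun z hz => mem_regularSet_of_im_ne_zero (ne_of_gt hz)
  have hDm : Dminus ⊆ regularSet ‖v₀‖ := fun z hz => mem_regularSet_of_im_ne_zero (ne_of_lt hz)
  refine ⟨fun t z => scatteringMatrix σ ‖v₀‖ (fun x => q x t) qm qp t z,
    fun t z hz => ⟨?_, ?_, fun G => ?_, ?_⟩, fun z hz Ψm Ψp hm hp s x t => ?_,
    fun t => ⟨?_, ?_, ?_, ?_⟩⟩
  · simp only [isJost_iff_eq (pm t hz)]
    exact existsUnique_eq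
  · simp only [isJost_iff_eq (pp t hz)]
    exact existsUnique_eq
  · simp only [IsScatteringMatrix, isJost_iff_eq (pm t hz), isJost_iff_eq (pp t hz)]
    -- The matrix is evaluated at `x = 0`; any other point would do, since `R₋ Ψ₊` is constant in
    -- `x`.
    rw [scatteringMatrix, ← (pm t hz).eq_mul_iff (pp t hz) 0]
    refine ⟨?_, fun h => ⟨_, _, rfl, rfl, h⟩⟩
    rintro ⟨_, _, rfl, rfl, h⟩
    exact h
  · exact IsUnit.of_mul_eq_one_right _ (hinv t z hz)
  · have em : ∀ t, (fun x => Ψm x t) = _ := fun t => (isJost_iff_eq (pm t hz) _).1 (hm.1 t)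
    have ep : ∀ t, (fun x => Ψp x t) = _ := fun t => (isJost_iff_eq (pp t hz) _).1 (hp.1 t)
    have hu : ∀ t, IsUnit (Ψm x t) := fun t => by
      rw [congrFun (em t) x]
      exact IsUnit.of_mul_eq_one_right _ ((pm t hz).dual_mul x)
    have hdet : ∀ t, IsUnit (Ψm x t).det := fun t => (Matrix.isUnit_iff_isUnit_det _).1 (hu t)
    have hH : ∀ t, Ψp x t
        = Ψm x t * scatteringMatrix σ ‖v₀‖ (fun x => q x t) qm qp t z := fun t => by
      rw [congrFun (em t) x, congrFun (ep t) x]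
      exact (pm t hz).eq_mul (pp t hz) x 0
    -- At fixed `x` the ratio `ψ₋⁻¹ ψ₊` takes the same value at times `t` and `s`; at time `s` it is
    -- the scattering matrix.
    have hratio := inv_mul_eq_inv_mul_of_hasDerivAt hu (hm.2 x) (hp.2 x) t s
    rw [hH s, ← Matrix.mul_assoc, Matrix.nonsing_inv_mul _ (hdet s), Matrix.one_mul] at hratio
    beta_reduce
    rw [← hratio, ← Matrix.mul_assoc, Matrix.mul_nonsing_inv _ (hdet t), Matrix.one_mul]
  · exact extendsAnalytically_congr (extendsAnalytically_scatteringMatrixInv hq₀ (hc t)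
      (hint_m t) (hint_p t) σ t isOpen_Dplus hDp
      fun z hz i => (eigenvalue_re_le _ (im_nonneg_of_mem hz) i).2)
      fun z hz => by rw [hS t z hz]
  · exact extendsAnalytically_scatteringMatrix hq₀ (hc t)
      (hint_m t) (hint_p t) σ t isOpen_Dplus hDp
      fun z hz i => (eigenvalue_re_le _ (im_nonneg_of_mem hz) i).1
  · exact extendsAnalytically_congr (extendsAnalytically_scatteringMatrixInv hq₀ (hc t)
      (hint_m t) (hint_p t) σ t isOpen_Dminus hDm
      fun z hz i => (eigenvalue_re_ge _ (im_nonpos_of_mem hz) i).2)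
      fun z hz => by rw [hS t z hz]
  · exact extendsAnalytically_scatteringMatrix hq₀ (hc t)
      (hint_m t) (hint_p t) σ t isOpen_Dminus hDm
      fun z hz i => (eigenvalue_re_ge _ (im_nonpos_of_mem hz) i).1
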